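/- Let $0<\gamma<1$, $\sigma=\gamma/(1-\gamma)$, $1<\alpha,\beta<2$, $x_R,y_R,T>0$, $\Omega=(0,x_R)\times(0,y_R)$. Let $u$ be a classical solution (continuous on $\overline\Omega\times[0,T]$, with all the derivatives below existing, and time derivative integrable on $(0,T)$) of $$ {}^{CF}_0D_t^\gamma u=\frac{\partial^\alpha u}{\partial|x|^\alpha}+\frac{\partial^\beta u}{\partial|y|^\beta}+f\ \text{ on }\Omega\times(0,T],\qquad u(\cdot,\cdot,0)=u_0\text{ on }\Omega,\qquad u=0\text{ on }\partial\Omega\times[0,T], $$ where ${}^{CF}_0D_t^\gamma v(t)=\frac1{1-\gamma}\int_0^t v'(s)e^{-\sigma(t-s)}\,ds$ and, for $v$ on $[0,L]$, $\kappa_\alpha=-\frac{1}{2\cos(\alpha\pi/2)}$, $$\frac{\partial^\alpha v}{\partial|x|^\alpha}(x)=\frac{\kappa_\alpha}{\Gamma(2-\alpha)}\frac{d^2}{dx^2}\left[\int_0^x(x-\xi)^{1-\alpha}v(\xi)\,d\xi\right]+\frac{\kappa_\alpha}{\Gamma(2-\alpha)}\frac{d^2}{dx^2}\left[\int_x^L(\xi-x)^{1-\alpha}v(\xi)\,d\xi\right].$$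 A mesh consists of integers $N_x,N_y\ge1$, $N\ge0$ and $\tau>0$ with $N\tau\le T$; put $\Delta x=x_R/N_x$, $\Delta y=y_R/N_y$, $x_i=i\Delta x$, $y_j=j\Delta y$, $t_n=n\tau$. Let $g_m^\alpha=\sum_{k=0}^4(-1)^k\binom4k\,(\max\{m+1-k,0\})^{3-\alpha}$ for $m\ge0$, and let $g^\alpha_{i,i}=2g^\alpha_1$, $g^\alpha_{i,i\pm1}=g_0^\alpha+g_2^\alpha$ and $g^\alpha_{i,m}=g^\alpha_{|i-m|+1}$ for $|i-m|\ge2$; similarly for $\beta$. The difference scheme is $$ u^n_{i,j}-\kappa^\alpha_{\Delta x,\tau}\sum_{m=0}^{N_x}g^\alpha_{i,m}u^n_{m,j}-\kappa^\beta_{\Delta y,\tau}\sum_{m=0}^{N_y}g^\beta_{j,m}u^n_{i,m}=\sum_{k=1}^{n-1}u^k_{i,j}e^{-\sigma(n-1-k)\tau}(1-e^{-\sigma\tau})+u^0_{i,j}e^{-\sigma(n-1)\tau}+\frac{(1-\gamma)\sigma\tau}{1-e^{-\sigma\tau}}f(x_i,y_j,t_n) $$ for $1\le n\le N$, $1\le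 i\le N_x-1$, $1\le j\le N_y-1$, with $u^0_{i,j}=u_0(x_i,y_j)$ at interior mesh points, $u^n_{i,j}=0$ at boundary mesh points for $0\le n\le N$, and $\kappa^\alpha_{\Delta x,\tau}=\frac{(1-\gamma)\sigma\tau}{1-e^{-\sigma\tau}}\frac{\kappa_\alpha}{\Gamma(4-\alpha)(\Delta x)^\alpha}$, $\kappa^\beta_{\Delta y,\tau}=\frac{(1-\gamma)\sigma\tau}{1-e^{-\sigma\tau}}\frac{\kappa_\beta}{\Gamma(4-\beta)(\Delta y)^\beta}$. The local truncation error is $$ r^n_{i,j}=\frac1{1-\gamma}\sum_{k=1}^n\frac{u(x_i,y_j,t_k)-u(x_i,y_j,t_{k-1})}{\sigma\tau}e^{-\sigma(n-k)\tau}(1-e^{-\sigma\tau})-\frac{\kappa_\alpha}{\Gamma(4-\alpha)(\Delta x)^\alpha}\sum_{m=0}^{N_x}g^\alpha_{i,m}u(x_m,y_j,t_n)-\frac{\kappa_\beta}{\Gamma(4-\beta)(\Delta y)^\beta}\sum_{m=0}^{N_y}g^\beta_{j,m}u(x_i,y_m,t_n)-f(x_i,y_j,t_n). $$ (a) Suppose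 that $u$ is sufficiently smooth: on $[0,T]$, for each $(x,y)\in\Omega$, $u$ is $C^2$ in $t$ with $|\partial_t^2u|$ bounded uniformly in $(x,y,t)$, and for each $t\in(0,T]$ the extension by zero in $x$ of $u(\cdot,y,t)$ ($0<y<y_R$) from $[0,x_R]$ to $\mathbb R$, and the extension by zero in $y$ of $u(x,\cdot,t)$ ($0<x<x_R$) from $[0,y_R]$ to $\mathbb R$, are $C^3$ with third derivatives Lipschitz, with uniform constants. Then there is $C_u>0$, the same for all meshes, such that $$|r^n_{i,j}|\le C_u\left(\tau^2+(\Delta x)^2+(\Delta y)^2\right)\qquad(1\le n\le N,\ 1\le i\le N_x-1,\ 1\le j\le N_y-1).\tag{$*$}$$ (b) Let $C_u>0$ satisfy $(*)$ on a given mesh (whether or not $u$ is smooth as in (a)), let $u^n_{i,j}$ be computed by the difference scheme on that mesh and let $\varepsilon^n_{i,j}=u(x_i,y_j,t_n)-u^n_{i,j}$. Then for every $1\le n\le N$ $$\|\varepsilon^n\|_\infty=\max_{0\le i\le N_x,\,0\le j\le N_y}|\varepsilon^n_{i,j}|\le(1-\gamma)\left(\sigma T+e^{\sigma\tau}\right)C_u\left(\tau^2+(\Delta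 x)^2+(\Delta y)^2\right).$$ -/

import Mathlib

open Set
open scoped NNReal

/-- Data of the initial-boundary value problem
`CF-D_t^γ u = ∂^α u/∂|x|^α + ∂^β u/∂|y|^β + f` on `(0, xR) × (0, yR)`, `0 < t ≤ T`,
with initial value `u0` and zero boundary values. -/
structure CFProblem where
  γ : ℝ
  α : ℝ
  β : ℝ
  xR : ℝ
  yR : ℝ
  T : ℝ
  /-- the source term `f x y t` -/
  f : ℝ → ℝ → ℝ → ℝ
  /-- the initial value `u0 x y` -/
  u0 : ℝ → ℝ → ℝ
  γ_pos : 0 < γ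
  γ_lt_one : γ < 1
  one_lt_α : 1 < α
  α_lt_two : α < 2
  one_lt_β : 1 < β
  β_lt_two : β < 2
  xR_pos : 0 < xR
  yR_pos : 0 < yR
  T_pos : 0 < T

/-- `σ = γ / (1 - γ)`. -/
noncomputable def CFProblem.σ (P : CFProblem) : ℝ := P.γ / (1 - P.γ)

/-! ### Fractional derivatives -/

/-- Caputo–Fabrizio derivative of order `γ` of `v` at time `t`. -/
noncomputable def caputoFabrizio (γ : ℝ) (v : ℝ → ℝ) (t : ℝ) : ℝ :=
  1 / (1 - γ) * ∫ s in (0 : ℝ)..t, deriv v s * Real.exp (-(γ / (1 - γ)) * (t - s))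

/-- `z ↦ ∫_0^z (z - ξ)^(1-α) v(ξ) dξ`. -/
noncomputable def leftFracIntegral (α : ℝ) (v : ℝ → ℝ) (z : ℝ) : ℝ :=
  ∫ ξ in (0 : ℝ)..z, (z - ξ) ^ (1 - α) * v ξ

/-- `z ↦ ∫_z^L (ξ - z)^(1-α) v(ξ) dξ`. -/
noncomputable def rightFracIntegral (α L : ℝ) (v : ℝ → ℝ) (z : ℝ) : ℝ :=
  ∫ ξ in z..L, (ξ - z) ^ (1 - α) * v ξ

/-- Left Riemann–Liouville derivative of order `α ∈ (1,2)` on `(0, L)`. -/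
noncomputable def leftRL (α : ℝ) (v : ℝ → ℝ) (x : ℝ) : ℝ :=
  1 / Real.Gamma (2 - α) * deriv (deriv (leftFracIntegral α v)) x

/-- Right Riemann–Liouville derivative of order `α ∈ (1,2)` on `(0, L)`. -/
noncomputable def rightRL (α L : ℝ) (v : ℝ → ℝ) (x : ℝ) : ℝ :=
  1 / Real.Gamma (2 - α) * deriv (deriv (rightFracIntegral α L v)) x

/-- `κ_α = -1 / (2 cos(απ/2))`. -/
noncomputable def rieszConst (α : ℝ) : ℝ := -1 / (2 * Real.cos (α * Real.pi / 2))

/-- Riesz derivative of order `α ∈ (1,2)` on `(0, L)`. -/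
noncomputable def rieszDeriv (α L : ℝ) (v : ℝ → ℝ) (x : ℝ) : ℝ :=
  rieszConst α * (leftRL α v x + rightRL α L v x)

/-- The time derivative of `v` exists on `(0, T)` and is integrable, so that the
Caputo–Fabrizio derivative of `v` is meaningful on `(0, T]`. -/
structure CFDifferentiable (T : ℝ) (v : ℝ → ℝ) : Prop where
  differentiable : ∀ t ∈ Ioo 0 T, DifferentiableAt ℝ v t
  integrable : IntervalIntegrable (deriv v) MeasureTheory.volume 0 T

/-- Both one-sided fractional integrals of `v` are twice differentiable on `(0, L)`, so that the
Riesz derivative of `v` is meaningful there (for `v` continuous on `[0, L]`). -/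
structure RieszDifferentiable (α L : ℝ) (v : ℝ → ℝ) : Prop where
  left₁ : ∀ x ∈ Ioo 0 L, DifferentiableAt ℝ (leftFracIntegral α v) x
  left₂ : ∀ x ∈ Ioo 0 L, DifferentiableAt ℝ (deriv (leftFracIntegral α v)) x
  right₁ : ∀ x ∈ Ioo 0 L, DifferentiableAt ℝ (rightFracIntegral α L v) x
  right₂ : ∀ x ∈ Ioo 0 L, DifferentiableAt ℝ (deriv (rightFracIntegral α L v)) x

/-! ### Exact solutions -/

/-- `u x y t` is a classical solution of the initial-boundary value problem on
`[0, xR] × [0, yR] × [0, T]`; values of `u` elsewhere play no role. -/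
structure IsExactSolution (P : CFProblem) (u : ℝ → ℝ → ℝ → ℝ) : Prop where
  continuous : ContinuousOn (fun p : ℝ × ℝ × ℝ => u p.1 p.2.1 p.2.2)
    (Icc 0 P.xR ×ˢ Icc 0 P.yR ×ˢ Icc 0 P.T)
  time_diff : ∀ x ∈ Ioo 0 P.xR, ∀ y ∈ Ioo 0 P.yR, CFDifferentiable P.T (fun t => u x y t)
  x_diff : ∀ y ∈ Ioo 0 P.yR, ∀ t ∈ Ioc 0 P.T, RieszDifferentiable P.α P.xR (fun x => u x y t)
  y_diff : ∀ x ∈ Ioo 0 P.xR, ∀ t ∈ Ioc 0 P.T, RieszDifferentiable P.β P.yR (fun y => u x y t)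
  equation : ∀ x ∈ Ioo 0 P.xR, ∀ y ∈ Ioo 0 P.yR, ∀ t ∈ Ioc 0 P.T,
    caputoFabrizio P.γ (fun s => u x y s) t
      = rieszDeriv P.α P.xR (fun ξ => u ξ y t) x
        + rieszDeriv P.β P.yR (fun η => u x η t) y + P.f x y t
  initial : ∀ x ∈ Ioo 0 P.xR, ∀ y ∈ Ioo 0 P.yR, u x y 0 = P.u0 x y
  boundary : ∀ x ∈ Icc 0 P.xR, ∀ y ∈ Icc 0 P.yR, ∀ t ∈ Icc 0 P.T,
    (x = 0 ∨ x = P.xR ∨ y = 0 ∨ y = P.yR) → u x y t = 0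

/-- Smoothness under which the difference formulas are second-order consistent:
`u` is `C²` in time with uniformly bounded second time derivative, and the extension of `u` by zero
across the boundary is, in each space variable, of class `C³` with uniformly Lipschitz third
derivative. -/
structure SufficientlySmooth (P : CFProblem) (u : ℝ → ℝ → ℝ → ℝ) : Prop where
  time : ∃ M : ℝ, ∀ x ∈ Ioo 0 P.xR, ∀ y ∈ Ioo 0 P.yR,
    ContDiffOn ℝ 2 (fun t => u x y t) (Icc 0 P.T) ∧
    ∀ t ∈ Icc 0 P.T, |iteratedDerivWithin 2 (fun s => u x y s) (Icc 0 P.T) t| ≤ M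
  space_x : ∃ K : ℝ≥0, ∀ y ∈ Ioo 0 P.yR, ∀ t ∈ Ioc 0 P.T,
    ContDiff ℝ 3 ((Icc 0 P.xR).indicator fun x => u x y t) ∧
    LipschitzWith K (iteratedDeriv 3 ((Icc 0 P.xR).indicator fun x => u x y t))
  space_y : ∃ K : ℝ≥0, ∀ x ∈ Ioo 0 P.xR, ∀ t ∈ Ioc 0 P.T,
    ContDiff ℝ 3 ((Icc 0 P.yR).indicator fun y => u x y t) ∧
    LipschitzWith K (iteratedDeriv 3 ((Icc 0 P.yR).indicator fun y => u x y t))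

/-! ### The mesh and the difference scheme -/

/-- A uniform mesh: `Nx`, `Ny` subintervals in space and `N` time steps of length `τ`,
with `N τ ≤ T`. -/
structure CFMesh (P : CFProblem) where
  Nx : ℕ
  Ny : ℕ
  N : ℕ
  τ : ℝ
  Nx_pos : 0 < Nx
  Ny_pos : 0 < Ny
  τ_pos : 0 < τ
  N_mul_τ_le : (N : ℝ) * τ ≤ P.T

namespace CFMesh

variable {P : CFProblem} (m : CFMesh P)

/-- `Δx = xR / Nx`. -/
noncomputable def Δx : ℝ := P.xR / m.Nx

/-- `Δy = yR / Ny`. -/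
noncomputable def Δy : ℝ := P.yR / m.Ny

/-- `x_i = i Δx`. -/
noncomputable def x (i : ℕ) : ℝ := i * m.Δx

/-- `y_j = j Δy`. -/
noncomputable def y (j : ℕ) : ℝ := j * m.Δy

/-- `t_n = n τ`. -/
noncomputable def t (n : ℕ) : ℝ := n * m.τ

/-- The maximum norm `max_{0 ≤ i ≤ Nx, 0 ≤ j ≤ Ny} |e i j|` of a grid function. -/
noncomputable def maxNorm (e : ℕ → ℕ → ℝ) : ℝ :=
  (Finset.range (m.Nx + 1) ×ˢ Finset.range (m.Ny + 1)).sup' ⟨(0, 0), by simp⟩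
    fun p => |e p.1 p.2|

end CFMesh

/-- The coefficients `g_k^α`. -/
noncomputable def gCoeff (α : ℝ) : ℕ → ℝ
  | 0 => 1
  | 1 => -4 + 2 ^ (3 - α)
  | 2 => 6 - 2 ^ (5 - α) + 3 ^ (3 - α)
  | (k + 3) => ((k : ℝ) + 4) ^ (3 - α) - 4 * ((k : ℝ) + 3) ^ (3 - α)
      + 6 * ((k : ℝ) + 2) ^ (3 - α) - 4 * ((k : ℝ) + 1) ^ (3 - α) + (k : ℝ) ^ (3 - α)

/-- The coefficients `g_{i,k}^α` of the discrete Riesz derivative. -/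
noncomputable def gMat (α : ℝ) (i k : ℕ) : ℝ :=
  if k + 1 < i then gCoeff α (i - k + 1)
  else if k + 1 = i then gCoeff α 0 + gCoeff α 2
  else if k = i then 2 * gCoeff α 1
  else if k = i + 1 then gCoeff α 0 + gCoeff α 2
  else gCoeff α (k - i + 1)

/-- `κ_{h,τ}^a = (1-γ)στ / (1 - e^{-στ}) · κ_a / (Γ(4-a) h^a)`. -/
noncomputable def schemeConst (P : CFProblem) (τ a h : ℝ) : ℝ :=
  (1 - P.γ) * P.σ * τ / (1 - Real.exp (-P.σ * τ))
    * (rieszConst a / (Real.Gamma (4 - a) * h ^ a))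

/-- The grid function `U n i j` (approximating `u(x_i, y_j, t_n)`) is computed by the difference
scheme, with the prescribed initial values and zero boundary values. -/
structure IsSchemeSolution (P : CFProblem) (m : CFMesh P) (U : ℕ → ℕ → ℕ → ℝ) : Prop where
  scheme : ∀ n i j : ℕ, 1 ≤ n → n ≤ m.N → 1 ≤ i → i < m.Nx → 1 ≤ j → j < m.Ny →
    U n i j
      - schemeConst P m.τ P.α m.Δx * ∑ k ∈ Finset.range (m.Nx + 1), gMat P.α i k * U n k j
      - schemeConst P m.τ P.β m.Δy * ∑ k ∈ Finset.range (m.Ny + 1), gMat P.β j k * U n i k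
    = ∑ k ∈ Finset.Icc 1 (n - 1), U k i j * Real.exp (-P.σ * ((n : ℝ) - 1 - (k : ℝ)) * m.τ)
          * (1 - Real.exp (-P.σ * m.τ))
      + U 0 i j * Real.exp (-P.σ * ((n : ℝ) - 1) * m.τ)
      + (1 - P.γ) * P.σ * m.τ / (1 - Real.exp (-P.σ * m.τ)) * P.f (m.x i) (m.y j) (m.t n)
  initial : ∀ i j : ℕ, 1 ≤ i → i < m.Nx → 1 ≤ j → j < m.Ny → U 0 i j = P.u0 (m.x i) (m.y j)
  boundary : ∀ n i j : ℕ, n ≤ m.N → i ≤ m.Nx → j ≤ m.Ny →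
    (i = 0 ∨ i = m.Nx ∨ j = 0 ∨ j = m.Ny) → U n i j = 0

/-- The local truncation error `r^n_{i,j}`: the residual of the mesh values of `u` in the
discretized equation. -/
noncomputable def truncationError (P : CFProblem) (m : CFMesh P) (u : ℝ → ℝ → ℝ → ℝ)
    (n i j : ℕ) : ℝ :=
  1 / (1 - P.γ) * ∑ k ∈ Finset.Icc 1 n,
      (u (m.x i) (m.y j) (m.t k) - u (m.x i) (m.y j) (m.t (k - 1))) / (P.σ * m.τ)
        * Real.exp (-P.σ * ((n : ℝ) - (k : ℝ)) * m.τ) * (1 - Real.exp (-P.σ * m.τ))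
    - rieszConst P.α / (Real.Gamma (4 - P.α) * m.Δx ^ P.α)
        * ∑ k ∈ Finset.range (m.Nx + 1), gMat P.α i k * u (m.x k) (m.y j) (m.t n)
    - rieszConst P.β / (Real.Gamma (4 - P.β) * m.Δy ^ P.β)
        * ∑ k ∈ Finset.range (m.Ny + 1), gMat P.β j k * u (m.x i) (m.y k) (m.t n)
    - P.f (m.x i) (m.y j) (m.t n)

/-- On the mesh `m` the constant `C` satisfies `|r^n_{i,j}| ≤ C (τ² + Δx² + Δy²)` at all interior
mesh points and all times `t_1, …, t_N`. -/
def TruncationBound (P : CFProblem) (m : CFMesh P) (u : ℝ → ℝ → ℝ → ℝ) (C : ℝ) : Prop :=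
  ∀ n i j : ℕ, 1 ≤ n → n ≤ m.N → 1 ≤ i → i < m.Nx → 1 ≤ j → j < m.Ny →
    |truncationError P m u n i j| ≤ C * (m.τ ^ 2 + m.Δx ^ 2 + m.Δy ^ 2)

/-! ### The coefficients of the discrete Riesz derivative -/

/-! Put s = 3 - α and D_s(x) = (x+1)^s - 2x^s + (x-1)^s. The coefficients g are the second backward
differences of the sequence b_0 = 1, b_m = D_s(m) (`rpowDiffSeq`, `gCoeff_add_two`), and both halves
of the theorem rest on a reading of b.

Stability. Since D_s' = s D_{s-1}, the function D_s is nonincreasing and convex on [1, ∞) for 1 ≤ s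
≤ 2. Convexity gives g_m ≥ 0 for m ≥ 3 and monotonicity makes the partial sums of g nonpositive;
together with g_0 + g_2 ≥ 0, the Riesz matrix has nonnegative off-diagonal entries and nonpositive
row sums. The implicit operator therefore obeys a maximum principle
(`abs_le_of_implicit_operator_le`). Summation by parts in time shows that the error solves the
scheme with zero initial data and a multiple of the truncation error as source (`error_equation`).
With θ = 1 - e^{-στ}, the sequence 1 + (n-1)θ solves the resulting scalar recursion exactly
(`sum_linear_mul_exp`), so induction on n proves (b) without a Gronwall constant.

Consistency in space. Up to the factor (2-α)(3-α), b_m is the integral of η^{1-α} against the hat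
function at m (`sum_rpowDiffSeq_mul`). Two summations by parts move the differences from b to u: the
discrete left derivative integrates η^{1-α} against the piecewise linear interpolant of centred
second difference quotients, while the Riemann–Liouville derivative integrates it against u'', the
zero extension being smooth. Difference quotient and interpolation each cost O(h²) when the third
derivative is Lipschitz. The right derivative follows by reflection.

Consistency in time. The discrete weights are exact integrals of the exponential kernel, so on each
cell v' is replaced by its mean. The defect has mean zero and sees only the variation of the kernel:
O(τ³) per cell, O(τ²) in total. -/

/-- The central second difference of `z ↦ z ^ s` with step one. -/
noncomputable def rpowSecondDiff (s x : ℝ) : ℝ := (x + 1) ^ s - 2 * x ^ s + (x - 1) ^ s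

theorem hasDerivAt_rpowSecondDiff {s x : ℝ} (hx : 1 < x) :
    HasDerivAt (rpowSecondDiff s) (s * rpowSecondDiff (s - 1) x) x := by
  have h1 : HasDerivAt (fun x : ℝ => (x + 1) ^ s) (1 * s * (x + 1) ^ (s - 1)) x :=
    ((hasDerivAt_id x).add_const 1).rpow_const (Or.inl (by simp only [id]; linarith))
  have h2 : HasDerivAt (fun x : ℝ => x ^ s) (1 * s * x ^ (s - 1)) x :=
    (hasDerivAt_id x).rpow_const (Or.inl (by simp only [id]; linarith))
  have h3 : HasDerivAt (fun x : ℝ => (x - 1) ^ s) (1 * s * (x - 1) ^ (s - 1)) x :=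
    ((hasDerivAt_id x).sub_const 1).rpow_const (Or.inl (by simp only [id]; linarith))
  refine ((h1.sub (h2.const_mul 2)).add h3).congr_deriv ?_
  unfold rpowSecondDiff
  ring

theorem continuous_rpowSecondDiff {s : ℝ} (hs : 0 ≤ s) : Continuous (rpowSecondDiff s) := by
  unfold rpowSecondDiff
  exact (((continuous_id.add continuous_const).rpow_const fun _ => Or.inr hs).sub
    (continuous_const.mul (continuous_id.rpow_const fun _ => Or.inr hs))).add
    ((continuous_id.sub continuous_const).rpow_const fun _ => Or.inr hs)

theorem rpowSecondDiff_nonpos {s x : ℝ} (hs₀ : 0 ≤ s) (hs₁ : s ≤ 1) (hx : 1 ≤ x) :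
    rpowSecondDiff s x ≤ 0 := by
  have h := (Real.concaveOn_rpow hs₀ hs₁).2
    (mem_Ici.2 (by linarith : 0 ≤ x + 1)) (mem_Ici.2 (by linarith : 0 ≤ x - 1))
    (by norm_num : (0 : ℝ) ≤ 1 / 2) (by norm_num : (0 : ℝ) ≤ 1 / 2) (by norm_num)
  simp only [smul_eq_mul] at h
  rw [show (1 / 2 : ℝ) * (x + 1) + 1 / 2 * (x - 1) = x by ring] at h
  unfold rpowSecondDiff
  linarith

/-- Writing each power as the square of its s/2 power, AM-GM bounds the outer terms below by 2 (x² -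
1)^{s/2}, and x² - 1 ≤ x² with a nonpositive exponent finishes. -/
theorem rpowSecondDiff_nonneg {s x : ℝ} (hs : s ≤ 0) (hx : 1 < x) :
    0 ≤ rpowSecondDiff s x := by
  have hsq : ∀ y : ℝ, 0 ≤ y → y ^ s = (y ^ (s / 2)) ^ 2 := fun y hy => by
    rw [← Real.rpow_natCast, ← Real.rpow_mul hy]
    norm_num
  have h1 : (x + 1) ^ (s / 2) * (x - 1) ^ (s / 2) = ((x + 1) * (x - 1)) ^ (s / 2) :=
    (Real.mul_rpow (by linarith) (by linarith)).symm
  have h2 : x ^ (s / 2) * x ^ (s / 2) = (x * x) ^ (s / 2) :=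
    (Real.mul_rpow (by linarith) (by linarith)).symm
  have h3 : (x * x) ^ (s / 2) ≤ ((x + 1) * (x - 1)) ^ (s / 2) :=
    Real.rpow_le_rpow_of_nonpos (by nlinarith) (by nlinarith) (by linarith)
  unfold rpowSecondDiff
  rw [hsq _ (by linarith : 0 ≤ x + 1), hsq _ (by linarith : 0 ≤ x), hsq _ (by linarith : 0 ≤ x - 1)]
  nlinarith [sq_nonneg ((x + 1) ^ (s / 2) - (x - 1) ^ (s / 2))]

theorem antitoneOn_rpowSecondDiff {s : ℝ} (hs₁ : 1 ≤ s) (hs₂ : s ≤ 2) :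
    AntitoneOn (rpowSecondDiff s) (Ici 1) := by
  refine antitoneOn_of_deriv_nonpos (convex_Ici 1)
    (continuous_rpowSecondDiff (by linarith)).continuousOn ?_ ?_ <;> rw [interior_Ici]
  · exact fun x hx => (hasDerivAt_rpowSecondDiff hx).differentiableAt.differentiableWithinAt
  · intro x hx
    rw [(hasDerivAt_rpowSecondDiff hx).deriv]
    exact mul_nonpos_of_nonneg_of_nonpos (by linarith)
      (rpowSecondDiff_nonpos (by linarith) (by linarith) (le_of_lt hx))

theorem convexOn_rpowSecondDiff {s : ℝ} (hs₁ : 1 ≤ s) (hs₂ : s ≤ 2) :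
    ConvexOn ℝ (Ici 1) (rpowSecondDiff s) := by
  have hd : ∀ x ∈ Ioi (1 : ℝ), HasDerivAt (fun y => s * rpowSecondDiff (s - 1) y)
      (s * ((s - 1) * rpowSecondDiff (s - 1 - 1) x)) x := fun x hx =>
    (hasDerivAt_rpowSecondDiff hx).const_mul s
  refine convexOn_of_hasDerivWithinAt2_nonneg (convex_Ici 1)
    (continuous_rpowSecondDiff (by linarith)).continuousOn
    (f' := fun y => s * rpowSecondDiff (s - 1) y)
    (f'' := fun x => s * ((s - 1) * rpowSecondDiff (s - 1 - 1) x)) ?_ ?_ ?_ <;>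
    rw [interior_Ici]
  · exact fun x hx => (hasDerivAt_rpowSecondDiff hx).hasDerivWithinAt
  · exact fun x hx => (hd x hx).hasDerivWithinAt
  · exact fun x hx => mul_nonneg (by linarith) (mul_nonneg (by linarith)
      (rpowSecondDiff_nonneg (by linarith) hx))

/-- Second backward differences of the sequence `max (m + 1) 0 ^ s`. -/
noncomputable def rpowDiffSeq (s : ℝ) : ℕ → ℝ
  | 0 => 1
  | m + 1 => rpowSecondDiff s (m + 1)

theorem gCoeff_zero (α : ℝ) : gCoeff α 0 = rpowDiffSeq (3 - α) 0 := rfl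

theorem gCoeff_one {α : ℝ} (hα : α < 2) :
    gCoeff α 1 = rpowDiffSeq (3 - α) 1 - 2 * rpowDiffSeq (3 - α) 0 := by
  have h0 : (0 : ℝ) ^ (3 - α) = 0 := Real.zero_rpow (by linarith)
  simp only [gCoeff, rpowDiffSeq, rpowSecondDiff]
  norm_num [h0]
  ring

theorem gCoeff_add_two {α : ℝ} (hα : α < 2) (m : ℕ) :
    gCoeff α (m + 2) = rpowDiffSeq (3 - α) (m + 2) - 2 * rpowDiffSeq (3 - α) (m + 1)
      + rpowDiffSeq (3 - α) m := by
  have h0 : (0 : ℝ) ^ (3 - α) = 0 := Real.zero_rpow (by linarith)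
  rcases m with _ | m
  · have h2 : (2 : ℝ) ^ (5 - α) = 4 * 2 ^ (3 - α) := by
      rw [show 5 - α = 2 + (3 - α) by ring, Real.rpow_add two_pos]
      norm_num
    simp only [gCoeff, rpowDiffSeq, rpowSecondDiff, h2]
    norm_num [h0]
    ring
  · simp only [gCoeff, rpowDiffSeq, rpowSecondDiff]
    push_cast
    rw [show (m : ℝ) + 2 + 1 + 1 = m + 4 by ring, show (m : ℝ) + 2 + 1 = m + 3 by ring,
      show (m : ℝ) + 1 + 1 + 1 = m + 3 by ring, show (m : ℝ) + 1 + 1 = m + 2 by ring, show (m : ℝ) + 3 - 1 = m + 2 by ring,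
      show (m : ℝ) + 2 - 1 = m + 1 by ring, show (m : ℝ) + 1 - 1 = m by ring]
    ring

/-- Midpoint convexity at m+1, m+2, m+3, all in [1, ∞). The index 2 escapes this argument because it
involves b_0 = 1. -/
theorem gCoeff_add_three_nonneg {α : ℝ} (h₁ : 1 ≤ α) (h₂ : α < 2) (m : ℕ) :
    0 ≤ gCoeff α (m + 3) := by
  have hm : (0 : ℝ) ≤ m := m.cast_nonneg
  have h := (convexOn_rpowSecondDiff (s := 3 - α) (by linarith) (by linarith)).2
    (mem_Ici.2 (by linarith : 1 ≤ (m : ℝ) + 3)) (mem_Ici.2 (by linarith : 1 ≤ (m : ℝ) + 1))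
    (by norm_num : (0 : ℝ) ≤ 1 / 2) (by norm_num : (0 : ℝ) ≤ 1 / 2) (by norm_num)
  simp only [smul_eq_mul] at h
  rw [show (1 / 2 : ℝ) * ((m : ℝ) + 3) + 1 / 2 * ((m : ℝ) + 1) = m + 2 by ring] at h
  rw [show m + 3 = (m + 1) + 2 by rfl, gCoeff_add_two h₂]
  simp only [rpowDiffSeq]
  push_cast
  rw [show (m : ℝ) + 2 + 1 = m + 3 by ring, show (m : ℝ) + 1 + 1 = m + 2 by ring]
  linarith

/-- With p = α - 1, multiplying by 2^p turns the claim into 9 (2/3)^p + 7·2^p ≥ 16, an equality at p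
= 0. The tangent bound e^x ≥ 1 + x reduces it to the slope 16 log 2 - 9 log 3 ≥ 0, that is 3^9 ≤
2^16. -/
theorem gCoeff_zero_add_two_nonneg {α : ℝ} (h₁ : 1 ≤ α) :
    0 ≤ gCoeff α 0 + gCoeff α 2 := by
  have e3 : (3 : ℝ) ^ (3 - α) = 9 * Real.exp ((1 - α) * Real.log 3) := by
    rw [show 3 - α = 2 + (1 - α) by ring, Real.rpow_add (by norm_num),
      Real.rpow_def_of_pos (by norm_num : (0 : ℝ) < 3) (1 - α), mul_comm (Real.log 3)]
    norm_num
  have e2 : (2 : ℝ) ^ (5 - α) = 16 * Real.exp ((1 - α) * Real.log 2) := by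
    rw [show 5 - α = 4 + (1 - α) by ring, Real.rpow_add (by norm_num),
      Real.rpow_def_of_pos (by norm_num : (0 : ℝ) < 2) (1 - α), mul_comm (Real.log 2)]
    norm_num
  have hl : 9 * Real.log 3 ≤ 16 * Real.log 2 := by
    have : Real.log ((3 : ℝ) ^ 9) ≤ Real.log ((2 : ℝ) ^ 16) :=
      Real.log_le_log (by norm_num) (by norm_num)
    rw [Real.log_pow, Real.log_pow] at this
    exact_mod_cast this
  have f1 := Real.add_one_le_exp ((α - 1) * (Real.log 2 - Real.log 3))
  have f2 := Real.add_one_le_exp ((α - 1) * Real.log 2)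
  have key : 16 ≤ 9 * Real.exp ((α - 1) * (Real.log 2 - Real.log 3))
      + 7 * Real.exp ((α - 1) * Real.log 2) := by
    nlinarith [mul_nonneg (sub_nonneg.2 h₁) (sub_nonneg.2 hl)]
  have p := mul_le_mul_of_nonneg_left key (Real.exp_pos ((1 - α) * Real.log 2)).le
  have q1 : Real.exp ((1 - α) * Real.log 2) * Real.exp ((α - 1) * (Real.log 2 - Real.log 3))
      = Real.exp ((1 - α) * Real.log 3) := by
    rw [← Real.exp_add]; congr 1; ring
  have q2 : Real.exp ((1 - α) * Real.log 2) * Real.exp ((α - 1) * Real.log 2) = 1 := by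
    rw [← Real.exp_add, ← Real.exp_zero]; congr 1; ring
  simp only [gCoeff, e3, e2]
  nlinarith [p, q1, q2]

theorem sum_gCoeff {α : ℝ} (hα : α < 2) (M : ℕ) :
    ∑ l ∈ Finset.range (M + 2), gCoeff α l
      = rpowDiffSeq (3 - α) (M + 1) - rpowDiffSeq (3 - α) M := by
  induction M with
  | zero => rw [Finset.sum_range_succ, Finset.sum_range_one, gCoeff_zero, gCoeff_one hα]; ring
  | succ M ih => rw [Finset.sum_range_succ, ih, gCoeff_add_two hα]; ring

/-- The partial sum telescopes to b_{M+2} - b_{M+1}. At least three terms are needed: b_1 - b_0 =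
2^s - 3 can be positive, as monotonicity of b starts only at index 1. -/
theorem sum_gCoeff_nonpos {α : ℝ} (h₁ : 1 ≤ α) (h₂ : α < 2) (M : ℕ) :
    ∑ l ∈ Finset.range (M + 3), gCoeff α l ≤ 0 := by
  have hm : (0 : ℝ) ≤ M := M.cast_nonneg
  rw [sum_gCoeff h₂ (M + 1), sub_nonpos]
  simp only [rpowDiffSeq]
  refine antitoneOn_rpowSecondDiff (by linarith) (by linarith)
    (mem_Ici.2 (by linarith)) (mem_Ici.2 ?_) ?_ <;> push_cast <;> linarith

/-! ### Structure of the Riesz matrix: reflection, signs and row sums -/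

/-- The contribution of the left fractional derivative to `gMat`. -/
noncomputable def gMatLeft (α : ℝ) (i k : ℕ) : ℝ := if k ≤ i + 1 then gCoeff α (i + 1 - k) else 0

/-- The right derivative is the left one seen through k ↦ N - k. The two bands overlap only on the
three central diagonals, which explains the special entries there. -/
theorem gMat_eq {α : ℝ} {N i k : ℕ} (hi : i ≤ N) (hk : k ≤ N) :
    gMat α i k = gMatLeft α i k + gMatLeft α (N - i) (N - k) := by
  unfold gMat gMatLeft
  rcases lt_trichotomy (k + 1) i with h | rfl | h
  · rw [if_pos h, if_pos (by omega), if_neg (by omega), add_zero]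
    congr 1; omega
  · rw [if_neg (by omega), if_pos rfl, if_pos (by omega), if_pos (by omega), add_comm]
    congr 2 <;> omega
  rw [if_neg (by omega), if_neg (by omega)]
  rcases lt_trichotomy k (i + 1) with h' | rfl | h'
  · obtain rfl : k = i := by omega
    rw [if_pos rfl, if_pos (by omega), if_pos (by omega), two_mul]
    congr 2 <;> omega
  · rw [if_neg (by omega), if_pos rfl, if_pos (by omega), if_pos (by omega)]
    congr 2 <;> omega
  · rw [if_neg (by omega), if_neg (by omega), if_neg (by omega), if_pos (by omega), zero_add]
    congr 1; omega

theorem sum_gMatLeft {N i : ℕ} (hi : i < N) (α : ℝ) (v : ℕ → ℝ) :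
    ∑ k ∈ Finset.range (N + 1), gMatLeft α i k * v k
      = ∑ l ∈ Finset.range (i + 2), gCoeff α l * v (i + 1 - l) := by
  rw [← Finset.sum_range_reflect (fun l => gCoeff α l * v (i + 1 - l)) (i + 2),
    ← Finset.sum_subset (s₁ := Finset.range (i + 2))]
  · refine Finset.sum_congr rfl fun k hk => ?_
    have hk' := Finset.mem_range.1 hk
    rw [gMatLeft, if_pos (by omega)]
    rw [show i + 2 - 1 - k = i + 1 - k by omega, show i + 1 - (i + 1 - k) = k by omega]
  · exact Finset.range_subset_range.2 (by omega)
  · intro k _ hk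
    rw [gMatLeft, if_neg (by rw [Finset.mem_range] at hk; omega), zero_mul]

theorem sum_gMat {N i : ℕ} (h0 : 0 < i) (hi : i < N) (α : ℝ) (v : ℕ → ℝ) :
    ∑ k ∈ Finset.range (N + 1), gMat α i k * v k
      = ∑ l ∈ Finset.range (i + 2), gCoeff α l * v (i + 1 - l)
        + ∑ l ∈ Finset.range (N - i + 2), gCoeff α l * v (N - (N - i + 1 - l)) := by
  rw [← sum_gMatLeft hi, ← sum_gMatLeft (N := N) (i := N - i) (by omega) α fun k => v (N - k),
    ← Finset.sum_range_reflect (fun k => gMatLeft α (N - i) k * v (N - k)),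
    ← Finset.sum_add_distrib]
  refine Finset.sum_congr rfl fun k hk => ?_
  have hk' := Finset.mem_range.1 hk
  rw [gMat_eq hi.le (by omega : k ≤ N), add_mul, show N + 1 - 1 - k = N - k by omega,
    show N - (N - k) = k by omega]

theorem sum_gMat_nonpos {α : ℝ} (h₁ : 1 ≤ α) (h₂ : α < 2) {N i : ℕ} (h0 : 0 < i) (hi : i < N) :
    ∑ k ∈ Finset.range (N + 1), gMat α i k ≤ 0 := by
  have h := sum_gMat h0 hi α fun _ => 1
  simp only [mul_one] at h
  rw [h]
  have a := sum_gCoeff_nonpos h₁ h₂ (i - 1)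
  have b := sum_gCoeff_nonpos h₁ h₂ (N - i - 1)
  rw [show i - 1 + 3 = i + 2 by omega] at a
  rw [show N - i - 1 + 3 = N - i + 2 by omega] at b
  linarith

theorem gMat_nonneg {α : ℝ} (h₁ : 1 ≤ α) (h₂ : α < 2) {i k : ℕ} (h : k ≠ i) :
    0 ≤ gMat α i k := by
  unfold gMat
  split_ifs with a b c
  · obtain ⟨m, hm⟩ : ∃ m, i - k + 1 = m + 3 := ⟨i - k - 2, by omega⟩
    rw [hm]; exact gCoeff_add_three_nonneg h₁ h₂ m
  · exact gCoeff_zero_add_two_nonneg h₁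
  · exact gCoeff_zero_add_two_nonneg h₁
  · obtain ⟨m, hm⟩ : ∃ m, k - i + 1 = m + 3 := ⟨k - i - 2, by omega⟩
    rw [hm]; exact gCoeff_add_three_nonneg h₁ h₂ m

theorem rieszConst_pos {α : ℝ} (h₁ : 1 < α) (h₂ : α < 2) : 0 < rieszConst α := by
  have hpi := Real.pi_pos
  have : Real.cos (α * Real.pi / 2) < 0 :=
    Real.cos_neg_of_pi_div_two_lt_of_lt (by nlinarith) (by nlinarith)
  exact div_pos_of_neg_of_neg (by norm_num) (by linarith)

/-- If the entries of row `i` off the diagonal are nonnegative and the row sum is nonpositive, then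
`∑ k, a k * v k` has the sign opposite to `v i` where `|v|` is maximal. -/
theorem sum_mul_mul_nonpos_of_isMax {s : Finset ℕ} {i : ℕ} {a v : ℕ → ℝ}
    (ha : ∀ k ∈ s, k ≠ i → 0 ≤ a k) (hsum : ∑ k ∈ s, a k ≤ 0) (hv : ∀ k ∈ s, |v k| ≤ |v i|) :
    (∑ k ∈ s, a k * v k) * v i ≤ 0 := by
  have h : (∑ k ∈ s, a k * v k) * v i ≤ ∑ k ∈ s, a k * |v i| ^ 2 := by
    rw [Finset.sum_mul]
    refine Finset.sum_le_sum fun k hk => ?_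
    by_cases hki : k = i
    · rw [hki, sq_abs]; apply le_of_eq; ring
    · rw [mul_assoc]
      refine mul_le_mul_of_nonneg_left ?_ (ha k hk hki)
      calc v k * v i ≤ |v k * v i| := le_abs_self _
        _ = |v k| * |v i| := abs_mul _ _
        _ ≤ |v i| * |v i| := mul_le_mul_of_nonneg_right (hv k hk) (abs_nonneg _)
        _ = |v i| ^ 2 := by ring
  refine h.trans ?_
  rw [← Finset.sum_mul]
  exact mul_nonpos_of_nonpos_of_nonneg hsum (sq_nonneg _)

/-! ### Stability of the difference scheme -/

theorem CFProblem.σ_pos (P : CFProblem) : 0 < P.σ :=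
  div_pos P.γ_pos (by linarith [P.γ_lt_one])

namespace CFMesh

variable {P : CFProblem} (m : CFMesh P)

theorem Δx_pos : 0 < m.Δx := div_pos P.xR_pos (Nat.cast_pos.2 m.Nx_pos)

theorem Δy_pos : 0 < m.Δy := div_pos P.yR_pos (Nat.cast_pos.2 m.Ny_pos)

theorem Nx_mul_Δx : m.Nx * m.Δx = P.xR :=
  mul_div_cancel₀ _ (Nat.cast_ne_zero.2 m.Nx_pos.ne')

theorem Ny_mul_Δy : m.Ny * m.Δy = P.yR :=
  mul_div_cancel₀ _ (Nat.cast_ne_zero.2 m.Ny_pos.ne')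

theorem x_mem_Icc {i : ℕ} (hi : i ≤ m.Nx) : m.x i ∈ Icc 0 P.xR :=
  ⟨mul_nonneg i.cast_nonneg m.Δx_pos.le, m.Nx_mul_Δx ▸
    mul_le_mul_of_nonneg_right (Nat.cast_le.2 hi) m.Δx_pos.le⟩

theorem y_mem_Icc {j : ℕ} (hj : j ≤ m.Ny) : m.y j ∈ Icc 0 P.yR :=
  ⟨mul_nonneg j.cast_nonneg m.Δy_pos.le, m.Ny_mul_Δy ▸
    mul_le_mul_of_nonneg_right (Nat.cast_le.2 hj) m.Δy_pos.le⟩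

theorem x_mem_Ioo {i : ℕ} (h0 : 0 < i) (hi : i < m.Nx) : m.x i ∈ Ioo 0 P.xR :=
  ⟨mul_pos (Nat.cast_pos.2 h0) m.Δx_pos, m.Nx_mul_Δx ▸
    mul_lt_mul_of_pos_right (Nat.cast_lt.2 hi) m.Δx_pos⟩

theorem y_mem_Ioo {j : ℕ} (h0 : 0 < j) (hj : j < m.Ny) : m.y j ∈ Ioo 0 P.yR :=
  ⟨mul_pos (Nat.cast_pos.2 h0) m.Δy_pos, m.Ny_mul_Δy ▸
    mul_lt_mul_of_pos_right (Nat.cast_lt.2 hj) m.Δy_pos⟩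

theorem t_mem_Icc {n : ℕ} (hn : n ≤ m.N) : m.t n ∈ Icc 0 P.T :=
  ⟨mul_nonneg n.cast_nonneg m.τ_pos.le,
    (mul_le_mul_of_nonneg_right (Nat.cast_le.2 hn) m.τ_pos.le).trans m.N_mul_τ_le⟩

theorem t_mem_Ioc {n : ℕ} (h0 : 0 < n) (hn : n ≤ m.N) : m.t n ∈ Ioc 0 P.T :=
  ⟨mul_pos (Nat.cast_pos.2 h0) m.τ_pos, (m.t_mem_Icc hn).2⟩

theorem x_zero : m.x 0 = 0 := by simp [x]

theorem x_Nx : m.x m.Nx = P.xR := m.Nx_mul_Δx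

theorem y_zero : m.y 0 = 0 := by simp [y]

theorem y_Ny : m.y m.Ny = P.yR := m.Ny_mul_Δy

end CFMesh

/-- Discrete maximum principle for the implicit operator of the difference scheme. -/
theorem abs_le_of_implicit_operator_le {α β : ℝ} (hα₁ : 1 ≤ α) (hα₂ : α < 2) (hβ₁ : 1 ≤ β)
    (hβ₂ : β < 2) {a b : ℝ} (ha : 0 ≤ a) (hb : 0 ≤ b) {Nx Ny : ℕ} {e : ℕ → ℕ → ℝ} {B : ℝ}
    (hB : 0 ≤ B)
    (hbd : ∀ i j, i ≤ Nx → j ≤ Ny → (i = 0 ∨ i = Nx ∨ j = 0 ∨ j = Ny) → e i j = 0)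
    (h : ∀ i j, 0 < i → i < Nx → 0 < j → j < Ny →
      |e i j - a * ∑ k ∈ Finset.range (Nx + 1), gMat α i k * e k j
        - b * ∑ k ∈ Finset.range (Ny + 1), gMat β j k * e i k| ≤ B)
    {i j : ℕ} (hi : i ≤ Nx) (hj : j ≤ Ny) : |e i j| ≤ B := by
  obtain ⟨⟨p, q⟩, hpq, hmax⟩ := Finset.exists_max_image
    (Finset.range (Nx + 1) ×ˢ Finset.range (Ny + 1)) (fun p => |e p.1 p.2|) ⟨(0, 0), by simp⟩
  simp only [Finset.mem_product, Finset.mem_range, Nat.lt_succ_iff, Prod.forall] at hpq hmax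
  obtain ⟨hp, hq⟩ := hpq
  refine (hmax i j ⟨hi, hj⟩).trans ?_
  by_cases hb' : p = 0 ∨ p = Nx ∨ q = 0 ∨ q = Ny
  · rw [hbd p q hp hq hb', abs_zero]
    exact hB
  push Not at hb'
  obtain ⟨hp0, hpN, hq0, hqN⟩ := hb'
  have h1 : (∑ k ∈ Finset.range (Nx + 1), gMat α p k * e k q) * e p q ≤ 0 :=
    sum_mul_mul_nonpos_of_isMax (v := fun k => e k q) (fun k _ hk => gMat_nonneg hα₁ hα₂ hk)
      (sum_gMat_nonpos hα₁ hα₂ (by omega) (by omega))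
      fun k hk => hmax k q ⟨by simpa [Nat.lt_succ_iff] using hk, hq⟩
  have h2 : (∑ k ∈ Finset.range (Ny + 1), gMat β q k * e p k) * e p q ≤ 0 :=
    sum_mul_mul_nonpos_of_isMax (v := fun k => e p k) (fun k _ hk => gMat_nonneg hβ₁ hβ₂ hk)
      (sum_gMat_nonpos hβ₁ hβ₂ (by omega) (by omega))
      fun k hk => hmax p k ⟨hp, by simpa [Nat.lt_succ_iff] using hk⟩
  have h3 := h p q (by omega) (by omega) (by omega) (by omega)
  set Sx := ∑ k ∈ Finset.range (Nx + 1), gMat α p k * e k q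
  set Sy := ∑ k ∈ Finset.range (Ny + 1), gMat β q k * e p k
  -- At a point where |e| is maximal both matrix terms have the sign opposite to e, so e² ≤
  -- (operator applied to e)·e ≤ B |e|, which is impossible when |e| > B.
  by_contra! hlt
  have h4 : e p q ^ 2 ≤ (e p q - a * Sx - b * Sy) * e p q := by
    nlinarith [mul_nonneg ha (neg_nonneg.2 h1), mul_nonneg hb (neg_nonneg.2 h2)]
  have h5 : (e p q - a * Sx - b * Sy) * e p q ≤ B * |e p q| :=
    (le_abs_self _).trans (abs_mul _ (e p q) ▸ mul_le_mul_of_nonneg_right h3 (abs_nonneg _))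
  rw [← sq_abs] at h4
  nlinarith

/-- Abel summation: the discrete memory term becomes the current value minus the weighted history
appearing in the scheme. For the induction, one more time step multiplies all older weights by
e^{-c}. -/
theorem sum_diff_mul_exp (v : ℕ → ℝ) (c : ℝ) (n : ℕ) (hn : 1 ≤ n) :
    ∑ k ∈ Finset.Icc 1 n, (v k - v (k - 1)) * Real.exp (-c * (n - k))
      = v n - ∑ k ∈ Finset.Icc 1 (n - 1), v k * Real.exp (-c * (n - 1 - k)) * (1 - Real.exp (-c))
        - v 0 * Real.exp (-c * (n - 1)) := by
  induction n, hn using Nat.le_induction with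
  | base => simp
  | succ n hn ih =>
    have hs : ∀ z : ℝ, Real.exp (-c * (z + 1)) = Real.exp (-c * z) * Real.exp (-c) := fun z => by
      rw [← Real.exp_add]; congr 1; ring
    have hs' : ∀ k : ℕ, Real.exp (-c * (((n + 1 : ℕ) : ℝ) - k))
        = Real.exp (-c * (n - k)) * Real.exp (-c) := fun k => by
      rw [← hs]; push_cast; ring_nf
    have hs'' : ∀ k : ℕ, Real.exp (-c * (((n + 1 : ℕ) : ℝ) - 1 - k))
        = Real.exp (-c * (n - 1 - k)) * Real.exp (-c) := fun k => by
      rw [← hs]; push_cast; ring_nf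
    have h0 : Real.exp (-c * (((n + 1 : ℕ) : ℝ) - 1))
        = Real.exp (-c * (n - 1)) * Real.exp (-c) := by
      rw [← hs]; push_cast; ring_nf
    have hn' : Real.exp (-c * ((n : ℝ) - 1 - n)) * Real.exp (-c) = 1 := by
      rw [← Real.exp_add, Real.exp_eq_one_iff]; ring
    have hn'' : Real.exp (-c * ((n : ℝ) - (n + 1 : ℕ))) * Real.exp (-c) = 1 := by
      rw [← Real.exp_add, Real.exp_eq_one_iff]; push_cast; ring
    obtain ⟨m, rfl⟩ : ∃ m, n = m + 1 := ⟨n - 1, by omega⟩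
    rw [Finset.sum_Icc_succ_top (by omega), Nat.add_sub_cancel,
      Finset.sum_Icc_succ_top (f := fun k => v k * _ * _) (by omega)]
    simp only [hs', hs'', h0, hn', hn'', mul_one]
    rw [Nat.add_sub_cancel] at ih
    have e1 : ∑ k ∈ Finset.Icc 1 (m + 1), (v k - v (k - 1)) *
        (Real.exp (-c * ((m + 1 : ℕ) - k)) * Real.exp (-c))
        = (∑ k ∈ Finset.Icc 1 (m + 1), (v k - v (k - 1)) * Real.exp (-c * ((m + 1 : ℕ) - k)))
          * Real.exp (-c) := by
      rw [Finset.sum_mul]; exact Finset.sum_congr rfl fun k _ => by ring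
    have e2 : ∑ k ∈ Finset.Icc 1 m, v k *
        (Real.exp (-c * ((m + 1 : ℕ) - 1 - k)) * Real.exp (-c)) * (1 - Real.exp (-c))
        = (∑ k ∈ Finset.Icc 1 m, v k * Real.exp (-c * ((m + 1 : ℕ) - 1 - k))
          * (1 - Real.exp (-c))) * Real.exp (-c) := by
      rw [Finset.sum_mul]; exact Finset.sum_congr rfl fun k _ => by ring
    rw [e1, e2, ih]
    ring

/-- This makes B_k = 1 + (k-1)θ, θ = 1 - e^{-c}, an exact solution of B_{n+1} = 1 + ∑_{k≤n} B_k
e^{-c(n-k)} θ, the recursion satisfied by the error bounds. -/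
theorem sum_linear_mul_exp (c : ℝ) (n : ℕ) :
    ∑ k ∈ Finset.Icc 1 n, (1 + (k - 1) * (1 - Real.exp (-c))) * Real.exp (-c * (n - k))
      * (1 - Real.exp (-c)) = n * (1 - Real.exp (-c)) := by
  induction n with
  | zero => simp
  | succ n ih =>
    have hs : ∀ k : ℕ, Real.exp (-c * (((n + 1 : ℕ) : ℝ) - k))
        = Real.exp (-c * (n - k)) * Real.exp (-c) := fun k => by
      rw [← Real.exp_add]; push_cast; ring_nf
    rw [Finset.sum_Icc_succ_top (by omega), sub_self, mul_zero, Real.exp_zero]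
    simp only [hs]
    have e : ∑ k ∈ Finset.Icc 1 n, (1 + ((k : ℝ) - 1) * (1 - Real.exp (-c))) *
        (Real.exp (-c * (n - k)) * Real.exp (-c)) * (1 - Real.exp (-c))
        = (∑ k ∈ Finset.Icc 1 n, (1 + ((k : ℝ) - 1) * (1 - Real.exp (-c))) *
        Real.exp (-c * (n - k)) * (1 - Real.exp (-c))) * Real.exp (-c) := by
      rw [Finset.sum_mul]; exact Finset.sum_congr rfl fun k _ => by ring
    rw [e, ih]
    push_cast
    ring

theorem schemeConst_nonneg (P : CFProblem) {τ a h : ℝ} (hτ : 0 < τ) (ha₁ : 1 < a) (ha₂ : a < 2)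
    (hh : 0 < h) : 0 ≤ schemeConst P τ a h := by
  have h1 : Real.exp (-P.σ * τ) ≤ 1 :=
    Real.exp_le_one_iff.2 (by nlinarith [mul_pos P.σ_pos hτ])
  have h2 := rieszConst_pos ha₁ ha₂
  have h3 := Real.Gamma_pos_of_pos (by linarith : 0 < 4 - a)
  refine mul_nonneg (div_nonneg (mul_nonneg (mul_nonneg ?_ P.σ_pos.le) hτ.le) ?_) ?_
  · linarith [P.γ_lt_one]
  · linarith
  · positivity

/-- The equation for the error of the difference scheme. -/
theorem error_equation {P : CFProblem} {u : ℝ → ℝ → ℝ → ℝ} (hu : IsExactSolution P u)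
    {m : CFMesh P} {U : ℕ → ℕ → ℕ → ℝ} (hU : IsSchemeSolution P m U)
    {n i j : ℕ} (hn : 1 ≤ n) (hnN : n ≤ m.N) (hi : 1 ≤ i) (hiN : i < m.Nx) (hj : 1 ≤ j)
    (hjN : j < m.Ny) {e : ℕ → ℕ → ℕ → ℝ}
    (he : e = fun n i j => u (m.x i) (m.y j) (m.t n) - U n i j) :
    e n i j
      - schemeConst P m.τ P.α m.Δx * ∑ k ∈ Finset.range (m.Nx + 1), gMat P.α i k * e n k j
      - schemeConst P m.τ P.β m.Δy * ∑ k ∈ Finset.range (m.Ny + 1), gMat P.β j k * e n i k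
    = ∑ k ∈ Finset.Icc 1 (n - 1), e k i j * Real.exp (-(P.σ * m.τ) * ((n : ℝ) - 1 - (k : ℝ)))
          * (1 - Real.exp (-(P.σ * m.τ)))
      + (1 - P.γ) * (P.σ * m.τ) / (1 - Real.exp (-(P.σ * m.τ))) * truncationError P m u n i j := by
  have hγ : 1 - P.γ ≠ 0 := by linarith [P.γ_lt_one]
  have hσ : P.σ ≠ 0 := P.σ_pos.ne'
  have hτ : m.τ ≠ 0 := m.τ_pos.ne'
  have hθ : 1 - Real.exp (-(P.σ * m.τ)) ≠ 0 := by
    have := Real.exp_lt_one_iff.2 (neg_neg_of_pos (mul_pos P.σ_pos m.τ_pos))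
    linarith
  have hs := hU.scheme n i j hn hnN hi hiN hj hjN
  -- The initial error vanishes, hence the error equation has no term with index 0.
  have hi0 : U 0 i j = u (m.x i) (m.y j) (m.t 0) := by
    rw [hU.initial i j hi hiN hj hjN, show m.t 0 = 0 by simp [CFMesh.t],
      hu.initial _ (m.x_mem_Ioo hi hiN) _ (m.y_mem_Ioo hj hjN)]
  have hd := sum_diff_mul_exp (fun k => u (m.x i) (m.y j) (m.t k)) (P.σ * m.τ) n hn
  -- This factor normalises the discrete time derivative to a plain sum of increments with kernel
  -- weights, and turns the spatial coefficients into `schemeConst`.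
  have hr : (1 - P.γ) * (P.σ * m.τ) / (1 - Real.exp (-(P.σ * m.τ))) * truncationError P m u n i j
      = ∑ k ∈ Finset.Icc 1 n, (u (m.x i) (m.y j) (m.t k) - u (m.x i) (m.y j) (m.t (k - 1)))
          * Real.exp (-(P.σ * m.τ) * (n - k))
        - schemeConst P m.τ P.α m.Δx
          * ∑ k ∈ Finset.range (m.Nx + 1), gMat P.α i k * u (m.x k) (m.y j) (m.t n)
        - schemeConst P m.τ P.β m.Δy
          * ∑ k ∈ Finset.range (m.Ny + 1), gMat P.β j k * u (m.x i) (m.y k) (m.t n)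
        - (1 - P.γ) * (P.σ * m.τ) / (1 - Real.exp (-(P.σ * m.τ)))
          * P.f (m.x i) (m.y j) (m.t n) := by
    have e1 : ∑ k ∈ Finset.Icc 1 n,
        (u (m.x i) (m.y j) (m.t k) - u (m.x i) (m.y j) (m.t (k - 1))) / (P.σ * m.τ)
          * Real.exp (-P.σ * ((n : ℝ) - (k : ℝ)) * m.τ) * (1 - Real.exp (-P.σ * m.τ))
        = (1 - Real.exp (-(P.σ * m.τ))) / (P.σ * m.τ) *
          ∑ k ∈ Finset.Icc 1 n, (u (m.x i) (m.y j) (m.t k) - u (m.x i) (m.y j) (m.t (k - 1)))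
          * Real.exp (-(P.σ * m.τ) * (n - k)) := by
      rw [Finset.mul_sum]
      refine Finset.sum_congr rfl fun k _ => ?_
      rw [neg_mul P.σ m.τ, show -P.σ * ((n : ℝ) - k) * m.τ = -(P.σ * m.τ) * (n - k) by ring]
      ring
    rw [truncationError, e1, schemeConst, schemeConst, neg_mul P.σ m.τ]
    field_simp
  have e2 : ∀ k : ℕ, Real.exp (-P.σ * ((n : ℝ) - 1 - k) * m.τ)
      = Real.exp (-(P.σ * m.τ) * (n - 1 - k)) := fun k => by congr 1; ring
  have e3 : Real.exp (-P.σ * ((n : ℝ) - 1) * m.τ) = Real.exp (-(P.σ * m.τ) * (n - 1)) := by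
    congr 1; ring
  simp only [e2, e3, neg_mul P.σ m.τ, mul_assoc (1 - P.γ) P.σ m.τ, hi0] at hs
  rw [hr, hd, he]
  simp only [mul_sub, sub_mul, Finset.sum_sub_distrib] at hs ⊢
  linarith

/-- Induction on n through the maximum principle gives |ε^n| ≤ D R (1 + (n-1)θ) with D = (1-γ)c/θ
and c = στ. Then Dθ = (1-γ)c turns the growth into (n-1)c ≤ σT, and the remaining c/θ is at most
e^c. -/
theorem maxNorm_error_le {P : CFProblem} {u : ℝ → ℝ → ℝ → ℝ} (hu : IsExactSolution P u)
    (m : CFMesh P) {C : ℝ} (hC : 0 < C) (hr : TruncationBound P m u C)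
    {U : ℕ → ℕ → ℕ → ℝ} (hU : IsSchemeSolution P m U) {n : ℕ} (hn : 1 ≤ n) (hnN : n ≤ m.N) :
    m.maxNorm (fun i j => u (m.x i) (m.y j) (m.t n) - U n i j)
      ≤ (1 - P.γ) * (P.σ * P.T + Real.exp (P.σ * m.τ)) * C
          * (m.τ ^ 2 + m.Δx ^ 2 + m.Δy ^ 2) := by
  obtain ⟨e, he⟩ : ∃ e : ℕ → ℕ → ℕ → ℝ,
    e = fun n i j => u (m.x i) (m.y j) (m.t n) - U n i j := ⟨_, rfl⟩
  set c := P.σ * m.τ with hc_def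
  set R := C * (m.τ ^ 2 + m.Δx ^ 2 + m.Δy ^ 2) with hR_def
  set θ := 1 - Real.exp (-c) with hθ_def
  have hc : 0 < c := mul_pos P.σ_pos m.τ_pos
  have hγ : 0 < 1 - P.γ := by linarith [P.γ_lt_one]
  have hθ : 0 < θ := by
    have := Real.exp_lt_one_iff.2 (neg_neg_of_pos hc)
    linarith
  have hR : 0 ≤ R := by positivity
  set D := (1 - P.γ) * c / θ with hD_def
  have hD : 0 ≤ D := by positivity
  have key : ∀ n, 1 ≤ n → n ≤ m.N → ∀ i j, i ≤ m.Nx → j ≤ m.Ny →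
      |e n i j| ≤ D * R * (1 + (n - 1) * θ) := by
    intro n
    induction n using Nat.strong_induction_on with
    | _ n ih =>
      intro hn hnN i j hi hj
      have hn1 : (0 : ℝ) ≤ n - 1 := by
        have : (1 : ℝ) ≤ n := Nat.one_le_cast.2 hn
        linarith
      refine abs_le_of_implicit_operator_le (e := e n) P.one_lt_α.le P.α_lt_two P.one_lt_β.le
        P.β_lt_two (schemeConst_nonneg P m.τ_pos P.one_lt_α P.α_lt_two m.Δx_pos)
        (schemeConst_nonneg P m.τ_pos P.one_lt_β P.β_lt_two m.Δy_pos) (by positivity) ?_ ?_ hi hj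
      · intro i j hi hj hb
        rw [he]
        simp only
        rw [hU.boundary n i j hnN hi hj hb, sub_zero]
        refine hu.boundary _ (m.x_mem_Icc hi) _ (m.y_mem_Icc hj) _ (m.t_mem_Icc hnN) ?_
        rcases hb with rfl | rfl | rfl | rfl
        · exact Or.inl m.x_zero
        · exact Or.inr (Or.inl m.x_Nx)
        · exact Or.inr (Or.inr (Or.inl m.y_zero))
        · exact Or.inr (Or.inr (Or.inr m.y_Ny))
      · intro i j hi hiN hj hjN
        rw [error_equation hu hU hn hnN hi hiN hj hjN he]
        refine (abs_add_le _ _).trans ?_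
        have h1 : |D * truncationError P m u n i j| ≤ D * R := by
          rw [abs_mul, abs_of_nonneg hD]
          exact mul_le_mul_of_nonneg_left (hr n i j hn hnN hi hiN hj hjN) hD
        have h2 : |∑ k ∈ Finset.Icc 1 (n - 1), e k i j * Real.exp (-c * ((n : ℝ) - 1 - k)) * θ|
            ≤ D * R * ((n - 1) * θ) := by
          have hs := sum_linear_mul_exp c (n - 1)
          rw [Nat.cast_sub hn, Nat.cast_one] at hs
          rw [← hs, Finset.mul_sum]
          refine (Finset.abs_sum_le_sum_abs _ _).trans (Finset.sum_le_sum fun k hk => ?_)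
          rw [Finset.mem_Icc] at hk
          rw [abs_mul, abs_mul, abs_of_pos hθ, abs_of_pos (Real.exp_pos _), ← mul_assoc,
            ← mul_assoc]
          exact mul_le_mul_of_nonneg_right (mul_le_mul_of_nonneg_right
            (ih k (by omega) hk.1 (by omega) i j hiN.le hjN.le) (Real.exp_pos _).le) hθ.le
        calc _ ≤ D * R * ((n - 1) * θ) + D * R := add_le_add h2 h1
          _ = D * R * (1 + (n - 1) * θ) := by ring
  refine Finset.sup'_le _ _ fun p hp => ?_
  simp only [Finset.mem_product, Finset.mem_range, Nat.lt_succ_iff] at hp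
  have h := key n hn hnN p.1 p.2 hp.1 hp.2
  rw [he] at h
  refine h.trans ?_
  -- Since θ e^c = e^c - 1, this is c + 1 ≤ e^c.
  have h1 : c / θ ≤ Real.exp c := by
    rw [div_le_iff₀ hθ, hθ_def, mul_sub, ← Real.exp_add, add_neg_cancel, Real.exp_zero, mul_one]
    linarith [Real.add_one_le_exp c]
  have h2 : (n - 1) * c ≤ P.σ * P.T := by
    have := (m.t_mem_Icc hnN).2
    rw [CFMesh.t] at this
    nlinarith [mul_le_mul_of_nonneg_left this P.σ_pos.le]
  calc D * R * (1 + (n - 1) * θ) = (1 - P.γ) * R * ((n - 1) * c + c / θ) := by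
        rw [hD_def]; field_simp; ring
    _ ≤ (1 - P.γ) * R * (P.σ * P.T + Real.exp c) :=
        mul_le_mul_of_nonneg_left (add_le_add h2 h1) (by positivity)
    _ = _ := by rw [hR_def]; ring

/-! ### Consistency of the discrete Riesz derivative -/

open MeasureTheory in
theorem intervalIntegrable_rpow_mul {p : ℝ} (hp : -1 < p) {g : ℝ → ℝ} (hg : Continuous g)
    (a b : ℝ) : IntervalIntegrable (fun η : ℝ => η ^ p * g η) volume a b :=
  (intervalIntegral.intervalIntegrable_rpow' hp).mul_continuousOn hg.continuousOn

/-- A convolution with a power may be differentiated under the integral sign. -/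
theorem hasDerivAt_integral_rpow_mul {p : ℝ} (hp : -1 < p) (A : ℝ) {w w' : ℝ → ℝ}
    (hw : ∀ x, HasDerivAt w (w' x) x) (hw' : Continuous w') (x : ℝ) :
    HasDerivAt (fun z => ∫ η in (0 : ℝ)..A, η ^ p * w (z - η))
      (∫ η in (0 : ℝ)..A, η ^ p * w' (x - η)) x := by
  -- The compact interval chosen for B contains every z - η with |z - x| < 1 and |η| ≤ |A|; the
  -- dominating function |η^p| B is integrable because p > -1.
  have hwc : Continuous w := continuous_iff_continuousAt.2 fun x => (hw x).continuousAt
  obtain ⟨B, hB⟩ := (isCompact_Icc (a := x - 1 - |A|) (b := x + 1 + |A|)).exists_bound_of_continuousOn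
    hw'.continuousOn
  have hint : ∀ {g : ℝ → ℝ}, Continuous g → ∀ z : ℝ, IntervalIntegrable
      (fun η : ℝ => η ^ p * g (z - η)) MeasureTheory.volume 0 A := fun hg z =>
    intervalIntegrable_rpow_mul hp (hg.comp (continuous_const.sub continuous_id)) 0 A
  refine (intervalIntegral.hasDerivAt_integral_of_dominated_loc_of_deriv_le
    (F' := fun z η => η ^ p * w' (z - η)) (bound := fun η => |η ^ p| * B)
    (Metric.ball_mem_nhds x one_pos)
    (Filter.Eventually.of_forall fun z =>
      (intervalIntegrable_iff.1 (hint hwc z)).aestronglyMeasurable)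
    (hint hwc x) (intervalIntegrable_iff.1 (hint hw' x)).aestronglyMeasurable ?_ ?_ ?_).2
  · refine Filter.Eventually.of_forall fun η hη z hz => ?_
    rw [norm_mul]
    refine mul_le_mul_of_nonneg_left (hB _ ?_) (abs_nonneg _)
    rw [Metric.mem_ball, Real.dist_eq, abs_lt] at hz
    have hη' : |η| ≤ |A| := by
      have := abs_sub_left_of_mem_uIcc (uIoc_subset_uIcc hη)
      simpa using this
    rw [abs_le] at hη'
    exact ⟨by linarith, by linarith⟩
  · exact (intervalIntegral.intervalIntegrable_rpow' hp).abs.mul_const B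
  · exact Filter.Eventually.of_forall fun η _ z _ =>
      ((hw (z - η)).comp_sub_const z η).const_mul _

/-- The Riemann–Liouville integral of a function vanishing to the left of `0`. -/
theorem leftFracIntegral_eq {α A z : ℝ} (hα : α < 2) {v w : ℝ → ℝ} (hw : Continuous w)
    (h0 : ∀ ξ ≤ 0, w ξ = 0) (hz0 : 0 ≤ z) (hzA : z ≤ A) (hv : ∀ ξ ∈ Icc 0 z, v ξ = w ξ) :
    leftFracIntegral α v z = ∫ η in (0 : ℝ)..A, η ^ (1 - α) * w (z - η) := by
  have hint : ∀ a b : ℝ, IntervalIntegrable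
      (fun η : ℝ => η ^ (1 - α) * w (z - η)) MeasureTheory.volume a b :=
    intervalIntegrable_rpow_mul (by linarith) (hw.comp (continuous_const.sub continuous_id))
  have h1 : ∫ η in z..A, η ^ (1 - α) * w (z - η) = 0 := by
    rw [intervalIntegral.integral_congr (g := fun _ => (0 : ℝ)), intervalIntegral.integral_zero]
    intro η hη
    rw [uIcc_of_le hzA] at hη
    simp only
    rw [h0 _ (by linarith [hη.1]), mul_zero]
  rw [← intervalIntegral.integral_add_adjacent_intervals (hint 0 z) (hint z A), h1, add_zero]
  have h2 := intervalIntegral.integral_comp_sub_left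
    (fun η : ℝ => η ^ (1 - α) * w (z - η)) z (a := 0) (b := z)
  rw [sub_self, sub_zero] at h2
  rw [← h2, leftFracIntegral]
  refine intervalIntegral.integral_congr fun ξ hξ => ?_
  rw [uIcc_of_le hz0] at hξ
  rw [hv ξ hξ, sub_sub_cancel]

/-! ### Taylor estimates under a Lipschitz third derivative -/

/-- `w` has the derivatives `w₁`, `w₂`, `w₃` on the real line and `w₃` is `K`-Lipschitz. -/
structure HasLipschitzThirdDeriv (K : ℝ) (w w₁ w₂ w₃ : ℝ → ℝ) : Prop where
  deriv₁ : ∀ x, HasDerivAt w (w₁ x) x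
  deriv₂ : ∀ x, HasDerivAt w₁ (w₂ x) x
  deriv₃ : ∀ x, HasDerivAt w₂ (w₃ x) x
  lipschitz : ∀ x y, |w₃ x - w₃ y| ≤ K * |x - y|

namespace HasLipschitzThirdDeriv

variable {K : ℝ} {w w₁ w₂ w₃ : ℝ → ℝ}

theorem continuous (h : HasLipschitzThirdDeriv K w w₁ w₂ w₃) : Continuous w :=
  continuous_iff_continuousAt.2 fun x => (h.deriv₁ x).continuousAt

theorem continuous₁ (h : HasLipschitzThirdDeriv K w w₁ w₂ w₃) : Continuous w₁ :=
  continuous_iff_continuousAt.2 fun x => (h.deriv₂ x).continuousAt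

theorem continuous₂ (h : HasLipschitzThirdDeriv K w w₁ w₂ w₃) : Continuous w₂ :=
  continuous_iff_continuousAt.2 fun x => (h.deriv₃ x).continuousAt

theorem nonneg (h : HasLipschitzThirdDeriv K w w₁ w₂ w₃) : 0 ≤ K := by
  simpa using (abs_nonneg _).trans (h.lipschitz 1 0)

theorem reflect (h : HasLipschitzThirdDeriv K w w₁ w₂ w₃) (L : ℝ) :
    HasLipschitzThirdDeriv K (fun x => w (L - x)) (fun x => -w₁ (L - x)) (fun x => w₂ (L - x))
      (fun x => -w₃ (L - x)) where
  deriv₁ x := (h.deriv₁ (L - x)).comp_const_sub L x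
  deriv₂ x := (((h.deriv₂ (L - x)).comp_const_sub L x).neg).congr_deriv (neg_neg _)
  deriv₃ x := (h.deriv₃ (L - x)).comp_const_sub L x
  lipschitz x y := by
    have := h.lipschitz (L - y) (L - x)
    rwa [show L - y - (L - x) = x - y by ring,
      show w₃ (L - y) - w₃ (L - x) = -w₃ (L - x) - -w₃ (L - y) by ring] at this

theorem taylor₂ (h : HasLipschitzThirdDeriv K w w₁ w₂ w₃) (a b : ℝ) :
    |w₂ b - w₂ a - w₃ a * (b - a)| ≤ K * (b - a) ^ 2 := by
  have hd : ∀ x, HasDerivAt (fun x => w₂ x - w₃ a * x) (w₃ x - w₃ a) x := fun x => by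
    exact ((h.deriv₃ x).sub ((hasDerivAt_id x).const_mul (w₃ a))).congr_deriv (by rw [mul_one])
  have := (convex_uIcc a b).norm_image_sub_le_of_norm_hasDerivWithin_le
    (f := fun x => w₂ x - w₃ a * x) (C := K * |b - a|)
    (fun x _ => (hd x).hasDerivWithinAt) (fun x hx => ?_) left_mem_uIcc right_mem_uIcc
  · rw [Real.norm_eq_abs, Real.norm_eq_abs, mul_assoc, ← sq, sq_abs] at this
    rwa [show w₂ b - w₂ a - w₃ a * (b - a) = w₂ b - w₃ a * b - (w₂ a - w₃ a * a) by ring]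
  · exact (h.lipschitz x a).trans
      (mul_le_mul_of_nonneg_left (abs_sub_left_of_mem_uIcc hx) h.nonneg)

/-- The two nodes lie at distance d around x and the weights cancel the linear Taylor terms; the
quadratic remainders add up to θ(1-θ) K d². -/
theorem interpolation (h : HasLipschitzThirdDeriv K w w₁ w₂ w₃) (x d : ℝ) {θ : ℝ} (h0 : 0 ≤ θ)
    (h1 : θ ≤ 1) : |(1 - θ) * w₂ (x + θ * d) + θ * w₂ (x - (1 - θ) * d) - w₂ x| ≤ K * d ^ 2 := by
  have e1 := h.taylor₂ x (x + θ * d)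
  have e2 := h.taylor₂ x (x - (1 - θ) * d)
  have hK := mul_nonneg h.nonneg (sq_nonneg d)
  rw [show x + θ * d - x = θ * d by ring] at e1
  rw [show x - (1 - θ) * d - x = -((1 - θ) * d) by ring] at e2
  have e : (1 - θ) * w₂ (x + θ * d) + θ * w₂ (x - (1 - θ) * d) - w₂ x
      = (1 - θ) * (w₂ (x + θ * d) - w₂ x - w₃ x * (θ * d))
        + θ * (w₂ (x - (1 - θ) * d) - w₂ x - w₃ x * -((1 - θ) * d)) := by ring
  rw [e]
  refine (abs_add_le _ _).trans ?_
  rw [abs_mul, abs_mul, abs_of_nonneg h0, abs_of_nonneg (sub_nonneg.2 h1)]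
  calc _ ≤ (1 - θ) * (K * (θ * d) ^ 2) + θ * (K * (-((1 - θ) * d)) ^ 2) :=
        add_le_add (mul_le_mul_of_nonneg_left e1 (sub_nonneg.2 h1))
          (mul_le_mul_of_nonneg_left e2 h0)
    _ = K * d ^ 2 * (θ * (1 - θ)) := by ring
    _ ≤ K * d ^ 2 * 1 := mul_le_mul_of_nonneg_left (by nlinarith) hK
    _ = _ := mul_one _

/-- In w₂(y+t) + w₂(y-t) - 2w₂(y) the third-derivative terms cancel, leaving 2K d². Integrating this
bound twice in t replaces any use of a fourth derivative. -/
theorem secondDiff (h : HasLipschitzThirdDeriv K w w₁ w₂ w₃) (y : ℝ) {d : ℝ} (hd : 0 < d) :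
    |(w (y + d) - 2 * w y + w (y - d)) / d ^ 2 - w₂ y| ≤ 2 * K * d ^ 2 := by
  have hK := h.nonneg
  have b2 : ∀ t ∈ Icc 0 d, |w₂ (y + t) + w₂ (y - t) - 2 * w₂ y| ≤ 2 * K * d ^ 2 := fun t ht => by
    have e1 := h.taylor₂ y (y + t)
    have e2 := h.taylor₂ y (y - t)
    rw [add_sub_cancel_left] at e1
    rw [show y - t - y = -t by ring] at e2
    have ht2 : K * t ^ 2 ≤ K * d ^ 2 :=
      mul_le_mul_of_nonneg_left (pow_le_pow_left₀ ht.1 ht.2 2) hK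
    rw [abs_le] at e1 e2 ⊢
    constructor <;> nlinarith
  have d1 : ∀ t, HasDerivAt (fun t => w₁ (y + t) - w₁ (y - t) - 2 * w₂ y * t)
      (w₂ (y + t) + w₂ (y - t) - 2 * w₂ y) t := fun t => by
    refine ((((h.deriv₂ (y + t)).comp_const_add y t).sub ((h.deriv₂ (y - t)).comp_const_sub y t)).sub
      ((hasDerivAt_id t).const_mul (2 * w₂ y))).congr_deriv ?_
    ring
  have d0 : ∀ t, HasDerivAt (fun t => w (y + t) + w (y - t) - w₂ y * t ^ 2)
      (w₁ (y + t) - w₁ (y - t) - 2 * w₂ y * t) t := fun t => by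
    refine ((((h.deriv₁ (y + t)).comp_const_add y t).add ((h.deriv₁ (y - t)).comp_const_sub y t)).sub
      ((hasDerivAt_pow 2 t).const_mul (w₂ y))).congr_deriv ?_
    push_cast; ring
  have b1 : ∀ t ∈ Icc 0 d, |w₁ (y + t) - w₁ (y - t) - 2 * w₂ y * t| ≤ 2 * K * d ^ 2 * d :=
    fun t ht => by
    have := norm_image_sub_le_of_norm_deriv_le_segment' (fun t _ => (d1 t).hasDerivWithinAt)
      (fun t ht => b2 t (Ico_subset_Icc_self ht)) t ht
    simp only [Real.norm_eq_abs, add_zero, sub_zero, sub_self, mul_zero] at this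
    exact this.trans (mul_le_mul_of_nonneg_left ht.2 (by positivity))
  have b0 := norm_image_sub_le_of_norm_deriv_le_segment' (fun t _ => (d0 t).hasDerivWithinAt)
      (fun t ht => b1 t (Ico_subset_Icc_self ht)) d (right_mem_Icc.2 hd.le)
  simp only [Real.norm_eq_abs, add_zero, sub_zero] at b0
  have hd2 : 0 < d ^ 2 := by positivity
  rw [show (w (y + d) - 2 * w y + w (y - d)) / d ^ 2 - w₂ y
    = (w (y + d) + w (y - d) - w₂ y * d ^ 2 - (w y + w y - w₂ y * 0 ^ 2)) / d ^ 2 by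
      field_simp; ring, abs_div, abs_of_pos hd2, div_le_iff₀ hd2]
  refine b0.trans (le_of_eq ?_)
  ring

/-- The Riemann–Liouville derivative of the restriction of `w` when `w` vanishes on `(-∞, 0]`. -/
theorem leftRL_eq (h : HasLipschitzThirdDeriv K w w₁ w₂ w₃) {α L A x : ℝ} (hα : α < 2)
    (h0 : ∀ ξ ≤ 0, w ξ = 0) {v : ℝ → ℝ} (hv : ∀ ξ ∈ Icc 0 L, v ξ = w ξ) (hx : x ∈ Ioo 0 L)
    (hA : x < A) :
    leftRL α v x = 1 / Real.Gamma (2 - α) * ∫ η in (0 : ℝ)..A, η ^ (1 - α) * w₂ (x - η) := by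
  -- Because w vanishes on (-∞, 0], the upper limit z can be frozen at A near x, and both
  -- derivatives fall on w.
  have hev : leftFracIntegral α v =ᶠ[nhds x]
      fun z => ∫ η in (0 : ℝ)..A, η ^ (1 - α) * w (z - η) := by
    filter_upwards [Ioo_mem_nhds hx.1 hx.2, Iio_mem_nhds hA] with z hz hzA
    exact leftFracIntegral_eq hα h.continuous h0 hz.1.le (le_of_lt hzA)
      fun ξ hξ => hv ξ ⟨hξ.1, hξ.2.trans hz.2.le⟩
  have hp : -1 < 1 - α := by linarith
  rw [leftRL, hev.deriv.deriv_eq, funext fun z =>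
    (hasDerivAt_integral_rpow_mul hp A h.deriv₁ h.continuous₁ z).deriv,
    (hasDerivAt_integral_rpow_mul hp A h.deriv₂ h.continuous₂ x).deriv]

end HasLipschitzThirdDeriv

/-! ### Summation by parts and hat-function weights -/

theorem sum_gCoeff_mul {α : ℝ} (hα : α < 2) (W : ℕ → ℝ) (M : ℕ) :
    ∑ l ∈ Finset.range (M + 2), gCoeff α l * W l
      = ∑ l ∈ Finset.range M, rpowDiffSeq (3 - α) l * (W l - 2 * W (l + 1) + W (l + 2))
        + rpowDiffSeq (3 - α) M * (W M - 2 * W (M + 1))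
        + rpowDiffSeq (3 - α) (M + 1) * W (M + 1) := by
  induction M with
  | zero =>
    rw [Finset.sum_range_succ, Finset.sum_range_one, gCoeff_zero, gCoeff_one hα,
      Finset.sum_range_zero]
    ring
  | succ M ih =>
    rw [Finset.sum_range_succ, ih, gCoeff_add_two hα, Finset.sum_range_succ _ M]
    ring

/-- The boundary terms of the double summation by parts involve only W at M and M + 1. -/
theorem sum_gCoeff_mul_of_eq_zero {α : ℝ} (hα : α < 2) {W : ℕ → ℝ} {M : ℕ}
    (hW : ∀ l, M ≤ l → W l = 0) :
    ∑ l ∈ Finset.range M, gCoeff α l * W l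
      = ∑ l ∈ Finset.range M, rpowDiffSeq (3 - α) l * (W l - 2 * W (l + 1) + W (l + 2)) := by
  have h := sum_gCoeff_mul hα W M
  rw [Finset.sum_range_succ, Finset.sum_range_succ, hW M le_rfl, hW (M + 1) (by omega)] at h
  simpa using h

theorem integral_rpow_mul_hat_right {α : ℝ} (hα : α < 2) (m : ℕ) :
    ∫ η in (m : ℝ)..m + 1, η ^ (1 - α) * (m + 1 - η)
      = (((m : ℝ) + 1) ^ (3 - α) - m ^ (3 - α)) / ((2 - α) * (3 - α))
        - (m : ℝ) ^ (2 - α) / (2 - α) := by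
  have hm : (0 : ℝ) ≤ m := m.cast_nonneg
  have e : ∀ η ∈ uIcc (m : ℝ) (m + 1), η ^ (1 - α) * (m + 1 - η)
      = ((m : ℝ) + 1) * η ^ (1 - α) - η ^ (2 - α) := fun η hη => by
    rw [uIcc_of_le (by linarith)] at hη
    rw [show 2 - α = 1 - α + 1 by ring, Real.rpow_add_one' (hm.trans hη.1) (by linarith)]
    ring
  rw [intervalIntegral.integral_congr e, intervalIntegral.integral_sub
    ((intervalIntegral.intervalIntegrable_rpow' (by linarith)).const_mul _)
    (intervalIntegral.intervalIntegrable_rpow' (by linarith)),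
    intervalIntegral.integral_const_mul, integral_rpow (Or.inl (by linarith)),
    integral_rpow (Or.inl (by linarith)), show 1 - α + 1 = 2 - α by ring,
    show 2 - α + 1 = 3 - α by ring, show 3 - α = 2 - α + 1 by ring,
    Real.rpow_add_one' hm (by linarith), Real.rpow_add_one' (by linarith) (by linarith)]
  have : 2 - α ≠ 0 := by linarith
  have : 2 - α + 1 ≠ 0 := by linarith
  field_simp
  ring

theorem integral_rpow_mul_hat_left {α : ℝ} (hα : α < 2) (m : ℕ) :
    ∫ η in (m : ℝ)..m + 1, η ^ (1 - α) * (η - m)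
      = ((m : ℝ) + 1) ^ (2 - α) / (2 - α)
        - (((m : ℝ) + 1) ^ (3 - α) - m ^ (3 - α)) / ((2 - α) * (3 - α)) := by
  have hm : (0 : ℝ) ≤ m := m.cast_nonneg
  have e : ∀ η ∈ uIcc (m : ℝ) (m + 1), η ^ (1 - α) * (η - m)
      = η ^ (2 - α) - (m : ℝ) * η ^ (1 - α) := fun η hη => by
    rw [uIcc_of_le (by linarith)] at hη
    rw [show 2 - α = 1 - α + 1 by ring, Real.rpow_add_one' (hm.trans hη.1) (by linarith)]
    ring
  rw [intervalIntegral.integral_congr e, intervalIntegral.integral_sub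
    (intervalIntegral.intervalIntegrable_rpow' (by linarith))
    ((intervalIntegral.intervalIntegrable_rpow' (by linarith)).const_mul _),
    intervalIntegral.integral_const_mul, integral_rpow (Or.inl (by linarith)),
    integral_rpow (Or.inl (by linarith)), show 1 - α + 1 = 2 - α by ring,
    show 2 - α + 1 = 3 - α by ring, show 3 - α = 2 - α + 1 by ring,
    Real.rpow_add_one' hm (by linarith), Real.rpow_add_one' (by linarith) (by linarith)]
  have : 2 - α ≠ 0 := by linarith
  have : 2 - α + 1 ≠ 0 := by linarith
  field_simp
  ring

/-- The weights `rpowDiffSeq` come from integrating the piecewise linear interpolant against a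
power. -/
theorem sum_rpowDiffSeq_mul {α : ℝ} (hα : α < 2) (c : ℕ → ℝ) {M : ℕ} (hc : c M = 0) :
    ∑ m ∈ Finset.range M, rpowDiffSeq (3 - α) m * c m
      = (2 - α) * (3 - α) * ∑ m ∈ Finset.range M,
        ∫ η in (m : ℝ)..m + 1, η ^ (1 - α) * ((m + 1 - η) * c m + (η - m) * c (m + 1)) := by
  have hp : -1 < 1 - α := by linarith
  have h2 : 2 - α ≠ 0 := by linarith
  have h3 : 3 - α ≠ 0 := by linarith
  have hI : ∀ m : ℕ,
      ∫ η in (m : ℝ)..m + 1, η ^ (1 - α) * ((m + 1 - η) * c m + (η - m) * c (m + 1))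
      = (∫ η in (m : ℝ)..m + 1, η ^ (1 - α) * (m + 1 - η)) * c m
        + (∫ η in (m : ℝ)..m + 1, η ^ (1 - α) * (η - m)) * c (m + 1) := fun m => by
    rw [← intervalIntegral.integral_mul_const, ← intervalIntegral.integral_mul_const,
      ← intervalIntegral.integral_add]
    · exact intervalIntegral.integral_congr fun η _ => by ring
    · exact (intervalIntegrable_rpow_mul hp (by fun_prop) _ _).mul_const _
    · exact (intervalIntegrable_rpow_mul hp (by fun_prop) _ _).mul_const _
  -- After finitely many cells the last hat function is only half covered; the extra term records
  -- this rising half and disappears once c vanishes at the last node.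
  have key : ∀ M : ℕ, ∑ m ∈ Finset.range (M + 1), rpowDiffSeq (3 - α) m * c m
      + (2 - α) * (3 - α) * (∫ η in (M : ℝ)..M + 1, η ^ (1 - α) * (η - M)) * c (M + 1)
      = (2 - α) * (3 - α) * ∑ m ∈ Finset.range (M + 1),
        ∫ η in (m : ℝ)..m + 1, η ^ (1 - α) * ((m + 1 - η) * c m + (η - m) * c (m + 1)) := by
    intro M
    induction M with
    | zero =>
      rw [Finset.sum_range_one, Finset.sum_range_one, hI 0, integral_rpow_mul_hat_right hα,
        integral_rpow_mul_hat_left hα]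
      simp only [Nat.cast_zero, zero_add, Real.one_rpow, Real.zero_rpow h2, Real.zero_rpow h3,
        rpowDiffSeq]
      field_simp
      ring
    | succ M ih =>
      rw [Finset.sum_range_succ _ (M + 1), Finset.sum_range_succ _ (M + 1), mul_add, ← ih, hI,
        integral_rpow_mul_hat_right hα, integral_rpow_mul_hat_left hα,
        integral_rpow_mul_hat_left hα]
      simp only [rpowDiffSeq, rpowSecondDiff]
      push_cast
      rw [add_sub_cancel_right]
      field_simp
      ring
  rcases M with _ | M
  · simp
  · rw [← key M, hc, mul_zero, add_zero]

/-- Consistency of the discrete left Riemann–Liouville derivative. -/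
theorem HasLipschitzThirdDeriv.leftRL_consistency {K : ℝ} {w w₁ w₂ w₃ : ℝ → ℝ}
    (h : HasLipschitzThirdDeriv K w w₁ w₂ w₃) {α : ℝ} (hα : α < 2) (h0 : ∀ ξ ≤ 0, w ξ = 0)
    {d : ℝ} (hd : 0 < d) (i : ℕ) :
    |1 / (Real.Gamma (4 - α) * d ^ α)
        * ∑ l ∈ Finset.range (i + 2), gCoeff α l * w (i * d + d - l * d)
      - 1 / Real.Gamma (2 - α)
        * ∫ η in (0 : ℝ)..(i + 2 : ℕ) * d, η ^ (1 - α) * w₂ (i * d - η)|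
      ≤ 3 * K * ((i + 2 : ℕ) * d) ^ (2 - α) / ((2 - α) * Real.Gamma (2 - α)) * d ^ 2 := by
  have hp : -1 < 1 - α := by linarith
  have h2 : 0 < 2 - α := by linarith
  have h3 : 0 < 3 - α := by linarith
  have hK := h.nonneg
  set M := i + 2 with hM
  set x := (i : ℝ) * d with hx
  set c : ℕ → ℝ := fun m =>
    (w (x - m * d + d) - 2 * w (x - m * d) + w (x - m * d - d)) / d ^ 2 with hc
  have hG : 0 < Real.Gamma (2 - α) := Real.Gamma_pos_of_pos h2
  have hG4 : Real.Gamma (4 - α) = (3 - α) * ((2 - α) * Real.Gamma (2 - α)) := by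
    rw [← Real.Gamma_add_one h2.ne', show 2 - α + 1 = 3 - α by ring, ← Real.Gamma_add_one h3.ne']
    congr 1; ring
  -- With M = i + 2, the node x + d - M d equals -d, so all omitted values of w, and all three in c
  -- M, are zero.
  have hMx : ∀ l : ℕ, M ≤ l → x + d - l * d ≤ 0 := fun l hl => by
    have : (i : ℝ) + 2 ≤ l := by exact_mod_cast hl
    nlinarith
  have hsum : ∑ l ∈ Finset.range M, gCoeff α l * w (x + d - l * d)
      = d ^ 2 * ((2 - α) * (3 - α) * ∑ m ∈ Finset.range M,
        ∫ η in (m : ℝ)..m + 1, η ^ (1 - α) * ((m + 1 - η) * c m + (η - m) * c (m + 1))) := by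
    have hcM : c M = 0 := by
      have := hMx M le_rfl
      simp only [hc]
      rw [h0 (x - M * d + d) (by linarith), h0 (x - M * d) (by linarith),
        h0 (x - M * d - d) (by linarith)]
      simp
    rw [sum_gCoeff_mul_of_eq_zero hα fun l hl => h0 _ (hMx l hl), ← sum_rpowDiffSeq_mul hα c hcM,
      Finset.mul_sum]
    refine Finset.sum_congr rfl fun m _ => ?_
    simp only [hc]
    push_cast
    rw [show x + d - m * d = x - m * d + d by ring,
      show x + d - ((m : ℝ) + 1) * d = x - m * d by ring,
      show x + d - ((m : ℝ) + 2) * d = x - m * d - d by ring]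
    field_simp
  have hw2 : Continuous fun η : ℝ => w₂ (x - η * d) :=
    h.continuous₂.comp (continuous_const.sub (continuous_id.mul continuous_const))
  have hint : ∫ η in (0 : ℝ)..M * d, η ^ (1 - α) * w₂ (x - η)
      = d ^ (2 - α) * ∑ m ∈ Finset.range M,
        ∫ η in (m : ℝ)..m + 1, η ^ (1 - α) * w₂ (x - η * d) := by
    have e1 := intervalIntegral.sum_integral_adjacent_intervals (a := fun m : ℕ => (m : ℝ)) (n := M)
      (fun k _ => intervalIntegrable_rpow_mul hp hw2 _ _)
    simp only [Nat.cast_add, Nat.cast_one, Nat.cast_zero] at e1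
    rw [e1]
    have e2 := intervalIntegral.mul_integral_comp_mul_right
      (f := fun η : ℝ => η ^ (1 - α) * w₂ (x - η)) (a := 0) (b := M) d
    rw [zero_mul] at e2
    rw [← e2, ← intervalIntegral.integral_const_mul, ← intervalIntegral.integral_const_mul]
    refine intervalIntegral.integral_congr fun η hη => ?_
    rw [uIcc_of_le M.cast_nonneg] at hη
    rw [Real.mul_rpow hη.1 hd.le, show 2 - α = 1 - α + 1 by ring,
      Real.rpow_add_one hd.ne']
    ring
  -- The constant 3 is 2 + 1: 2K d² from the second difference quotients and K d² from interpolating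
  -- w₂ between the cell's nodes.
  have hcell : ∀ m : ℕ, |(∫ η in (m : ℝ)..m + 1,
        η ^ (1 - α) * ((m + 1 - η) * c m + (η - m) * c (m + 1)))
      - ∫ η in (m : ℝ)..m + 1, η ^ (1 - α) * w₂ (x - η * d)|
      ≤ ∫ η in (m : ℝ)..m + 1, η ^ (1 - α) * (3 * K * d ^ 2) := fun m => by
    rw [← Real.norm_eq_abs, ← intervalIntegral.integral_sub
      (intervalIntegrable_rpow_mul hp (by fun_prop) _ _) (intervalIntegrable_rpow_mul hp hw2 _ _)]
    refine intervalIntegral.norm_integral_le_of_norm_le (a := (m : ℝ)) (b := m + 1) (by linarith)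
      (Filter.Eventually.of_forall fun η hη => ?_)
      (intervalIntegrable_rpow_mul hp continuous_const _ _)
    have hη0 : (0 : ℝ) ≤ η := (Nat.cast_nonneg m).trans hη.1.le
    rw [← mul_sub, norm_mul, Real.norm_of_nonneg (Real.rpow_nonneg hη0 _)]
    refine mul_le_mul_of_nonneg_left ?_ (Real.rpow_nonneg hη0 _)
    have b0 := h.secondDiff (x - m * d) hd
    have b1 := h.secondDiff (x - (m + 1 : ℕ) * d) hd
    have b2 := h.interpolation (x - η * d) d (θ := η - m) (by linarith [hη.1]) (by linarith [hη.2])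
    rw [show x - η * d + (η - m) * d = x - m * d by ring,
      show x - η * d - (1 - (η - m)) * d = x - (m + 1 : ℕ) * d by push_cast; ring] at b2
    rw [Real.norm_eq_abs, show (m + 1 - η) * c m + (η - m) * c (m + 1) - w₂ (x - η * d)
      = ((1 - (η - m)) * (c m - w₂ (x - m * d))
          + (η - m) * (c (m + 1) - w₂ (x - (m + 1 : ℕ) * d)))
        + ((1 - (η - m)) * w₂ (x - m * d) + (η - m) * w₂ (x - (m + 1 : ℕ) * d)
          - w₂ (x - η * d)) by ring]
    have hl : 0 ≤ η - m := by linarith [hη.1]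
    have hr : 0 ≤ 1 - (η - m) := by linarith [hη.2]
    refine (abs_add_le _ _).trans ?_
    have b3 := abs_add_le ((1 - (η - m)) * (c m - w₂ (x - m * d)))
      ((η - m) * (c (m + 1) - w₂ (x - (m + 1 : ℕ) * d)))
    rw [abs_mul, abs_mul, abs_of_nonneg hl, abs_of_nonneg hr] at b3
    have b4 := mul_le_mul_of_nonneg_left b0 hr
    have b5 := mul_le_mul_of_nonneg_left b1 hl
    simp only [hc] at b3 ⊢
    linarith
  have htot : ∑ m ∈ Finset.range M, ∫ η in (m : ℝ)..m + 1, η ^ (1 - α) * (3 * K * d ^ 2)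
      = (M : ℝ) ^ (2 - α) / (2 - α) * (3 * K * d ^ 2) := by
    have e1 := intervalIntegral.sum_integral_adjacent_intervals (a := fun m : ℕ => (m : ℝ)) (n := M)
      (fun k _ => intervalIntegrable_rpow_mul hp (continuous_const (y := 3 * K * d ^ 2)) _ _)
    simp only [Nat.cast_add, Nat.cast_one, Nat.cast_zero] at e1
    rw [e1, intervalIntegral.integral_mul_const, integral_rpow (Or.inl hp),
      show 1 - α + 1 = 2 - α by ring, Real.zero_rpow h2.ne', sub_zero]
  have hdα : d ^ (2 - α) * d ^ α = d ^ 2 := by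
    rw [← Real.rpow_add hd, ← Real.rpow_natCast]; congr 1; push_cast; ring
  have hdpos : 0 < d ^ α := Real.rpow_pos_of_pos hd _
  have hdpos' : 0 < d ^ (2 - α) := Real.rpow_pos_of_pos hd _
  rw [hsum, hint, hG4, ← hdα]
  set S := ∑ m ∈ Finset.range M,
        ∫ η in (m : ℝ)..m + 1, η ^ (1 - α) * ((m + 1 - η) * c m + (η - m) * c (m + 1))
  set S' := ∑ m ∈ Finset.range M, ∫ η in (m : ℝ)..m + 1, η ^ (1 - α) * w₂ (x - η * d)
  have hS : |S - S'| ≤ (M : ℝ) ^ (2 - α) / (2 - α) * (3 * K * d ^ 2) := by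
    rw [← htot, ← Finset.sum_sub_distrib]
    exact (Finset.abs_sum_le_sum_abs _ _).trans (Finset.sum_le_sum fun m _ => hcell m)
  rw [show 1 / ((3 - α) * ((2 - α) * Real.Gamma (2 - α)) * d ^ α)
      * (d ^ (2 - α) * d ^ α * ((2 - α) * (3 - α) * S))
      - 1 / Real.Gamma (2 - α) * (d ^ (2 - α) * S')
      = d ^ (2 - α) / Real.Gamma (2 - α) * (S - S') by field_simp, abs_mul,
    abs_of_pos (div_pos hdpos' hG), Real.mul_rpow M.cast_nonneg hd.le, hdα]
  refine (mul_le_mul_of_nonneg_left hS (div_pos hdpos' hG).le).trans (le_of_eq ?_)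
  field_simp

/-! ### From the left derivative to the Riesz derivative -/

theorem rightRL_eq_leftRL (α L : ℝ) (v : ℝ → ℝ) (x : ℝ) :
    rightRL α L v x = leftRL α (fun ξ => v (L - ξ)) (L - x) := by
  have h : rightFracIntegral α L v
      = fun z => leftFracIntegral α (fun ξ => v (L - ξ)) (L - z) := by
    funext z
    have h1 := intervalIntegral.integral_comp_sub_left
      (fun ξ : ℝ => (ξ - z) ^ (1 - α) * v ξ) L (a := 0) (b := L - z)
    rw [sub_sub_cancel, sub_zero] at h1
    rw [rightFracIntegral, ← h1, leftFracIntegral]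
    exact intervalIntegral.integral_congr fun ξ _ => by rw [sub_right_comm]
  rw [rightRL, leftRL, h]
  have h2 : (deriv fun z => leftFracIntegral α (fun ξ => v (L - ξ)) (L - z))
      = fun z => -deriv (leftFracIntegral α fun ξ => v (L - ξ)) (L - z) :=
    funext fun z => deriv_comp_const_sub _ _ _
  rw [h2, deriv.fun_neg, deriv_comp_const_sub (deriv (leftFracIntegral α fun ξ => v (L - ξ))),
    neg_neg]

/-- Consistency of the discrete Riesz derivative, with an explicit constant. -/
theorem rieszDeriv_consistency {K : ℝ} {v w₁ w₂ w₃ : ℝ → ℝ} {L : ℝ}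
    (h : HasLipschitzThirdDeriv K ((Icc 0 L).indicator v) w₁ w₂ w₃) {α : ℝ} (hα₁ : 1 < α)
    (hα₂ : α < 2) {N i : ℕ} {d : ℝ} (hd : 0 < d) (hL : N * d = L) (hi0 : 0 < i) (hi : i < N) :
    |rieszConst α / (Real.Gamma (4 - α) * d ^ α)
        * ∑ k ∈ Finset.range (N + 1), gMat α i k * v (k * d) - rieszDeriv α L v (i * d)|
      ≤ rieszConst α * (2 * (3 * K * (2 * L) ^ (2 - α) / ((2 - α) * Real.Gamma (2 - α))))
        * d ^ 2 := by
  set w := (Icc 0 L).indicator v with hw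
  have hvw : ∀ ξ ∈ Icc 0 L, v ξ = w ξ := fun ξ hξ => (indicator_of_mem hξ v).symm
  have hclosed : IsClosed {z | w z = 0} := isClosed_eq h.continuous continuous_const
  -- The indicator gives zero only for ξ < 0; the endpoint, where the value is v 0, follows from
  -- continuity of the extension.
  have hleft : ∀ ξ ≤ 0, w ξ = 0 := by
    have : closure (Iio (0 : ℝ)) ⊆ {z | w z = 0} := closure_minimal
      (fun z hz => indicator_of_notMem (fun hz' => (not_lt.2 hz'.1) hz) v) hclosed
    rw [closure_Iio] at this
    exact this
  have hright : ∀ ξ ≤ 0, w (L - ξ) = 0 := by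
    have : closure (Ioi L) ⊆ {z | w z = 0} := closure_minimal
      (fun z hz => indicator_of_notMem (fun hz' => (not_lt.2 hz'.2) hz) v) hclosed
    rw [closure_Ioi] at this
    exact fun ξ hξ => this (by rw [mem_Ici]; linarith)
  have hG : 0 < Real.Gamma (2 - α) := Real.Gamma_pos_of_pos (by linarith)
  have hK := h.nonneg
  -- The integration range reaches at most one step beyond L, and (N + 1) d ≤ 2L makes the constant
  -- independent of the mesh.
  have hbound : ∀ j : ℕ, j < N →
      3 * K * ((j + 2 : ℕ) * d) ^ (2 - α) / ((2 - α) * Real.Gamma (2 - α)) * d ^ 2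
      ≤ 3 * K * (2 * L) ^ (2 - α) / ((2 - α) * Real.Gamma (2 - α)) * d ^ 2 := fun j hj => by
    have h2 : 0 < 2 - α := by linarith
    have h3 : ((j + 2 : ℕ) : ℝ) ≤ 2 * N := by exact_mod_cast (by omega : j + 2 ≤ 2 * N)
    have h4 : ((j + 2 : ℕ) * d : ℝ) ≤ 2 * L := by
      rw [← hL, ← mul_assoc]; exact mul_le_mul_of_nonneg_right h3 hd.le
    have h5 := Real.rpow_le_rpow (by positivity) h4 h2.le
    gcongr
  have hmem : ∀ j : ℕ, 0 < j → j < N → (j : ℝ) * d ∈ Ioo 0 L := fun j h0 hj =>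
    ⟨by positivity, hL ▸ mul_lt_mul_of_pos_right (Nat.cast_lt.2 hj) hd⟩
  have hmem' : ∀ j : ℕ, j ≤ N → (j : ℝ) * d ∈ Icc 0 L := fun j hj =>
    ⟨by positivity, hL ▸ mul_le_mul_of_nonneg_right (Nat.cast_le.2 hj) hd.le⟩
  have hlt : ∀ j : ℕ, (j : ℝ) * d < (j + 2 : ℕ) * d := fun j =>
    mul_lt_mul_of_pos_right (by push_cast; linarith) hd
  have hA := (h.leftRL_consistency hα₂ hleft hd i).trans (hbound i hi)
  have hB := ((h.reflect L).leftRL_consistency hα₂ hright hd (N - i)).trans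
    (hbound (N - i) (by omega))
  rw [← h.leftRL_eq hα₂ hleft hvw (hmem i hi0 hi) (hlt i)] at hA
  have hvw' : ∀ ξ ∈ Icc 0 L, v (L - ξ) = w (L - ξ) := fun ξ hξ =>
    hvw _ ⟨by linarith [hξ.2], by linarith [hξ.1]⟩
  have hxr : ((N - i : ℕ) : ℝ) * d = L - i * d := by
    rw [Nat.cast_sub hi.le, ← hL]; ring
  rw [← (h.reflect L).leftRL_eq (v := fun ξ => v (L - ξ)) hα₂ hright hvw'
    (hmem (N - i) (by omega) (by omega)) (hlt (N - i))] at hB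
  have sA : ∑ l ∈ Finset.range (i + 2), gCoeff α l * w (i * d + d - l * d)
      = ∑ l ∈ Finset.range (i + 2), gCoeff α l * v ((i + 1 - l : ℕ) * d) := by
    refine Finset.sum_congr rfl fun l hl => ?_
    rw [Finset.mem_range] at hl
    rw [hvw _ (hmem' _ (by omega)), Nat.cast_sub (by omega)]
    push_cast
    congr 2; ring
  have sB : ∑ l ∈ Finset.range (N - i + 2),
        gCoeff α l * w (L - ((N - i : ℕ) * d + d - l * d))
      = ∑ l ∈ Finset.range (N - i + 2), gCoeff α l * v ((N - (N - i + 1 - l) : ℕ) * d) := by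
    refine Finset.sum_congr rfl fun l hl => ?_
    rw [Finset.mem_range] at hl
    by_cases hl0 : l = 0
    · subst hl0
      rw [hvw _ (hmem' _ (by omega)), show N - (N - i + 1 - 0) = i - 1 by omega,
        Nat.cast_sub hi.le, Nat.cast_sub (by omega), ← hL]
      push_cast
      congr 2; ring
    · rw [hvw _ (hmem' _ (by omega)), show N - (N - i + 1 - l) = i + l - 1 by omega,
        Nat.cast_sub hi.le, Nat.cast_sub (by omega), ← hL]
      push_cast
      congr 2; ring
  rw [sA] at hA
  rw [sB, hxr, ← rightRL_eq_leftRL] at hB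
  rw [sum_gMat hi0 hi α fun k => v (k * d), rieszDeriv]
  have hκ := rieszConst_pos hα₁ hα₂
  set SA := ∑ l ∈ Finset.range (i + 2), gCoeff α l * v ((i + 1 - l : ℕ) * d)
  set SB := ∑ l ∈ Finset.range (N - i + 2), gCoeff α l * v ((N - (N - i + 1 - l) : ℕ) * d)
  set G := Real.Gamma (4 - α) * d ^ α
  rw [show rieszConst α / G * (SA + SB)
      - rieszConst α * (leftRL α v (i * d) + rightRL α L v (i * d))
      = rieszConst α * ((1 / G * SA - leftRL α v (i * d)) + (1 / G * SB - rightRL α L v (i * d))) by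
        ring, abs_mul, abs_of_pos hκ, mul_assoc]
  refine mul_le_mul_of_nonneg_left ((abs_add_le _ _).trans ?_) hκ.le
  linarith

theorem hasLipschitzThirdDeriv_of_contDiff {K : ℝ≥0} {w : ℝ → ℝ} (hw : ContDiff ℝ 3 w)
    (hK : LipschitzWith K (iteratedDeriv 3 w)) :
    HasLipschitzThirdDeriv K w (iteratedDeriv 1 w) (iteratedDeriv 2 w) (iteratedDeriv 3 w) := by
  have hd : ∀ m : ℕ, m < 3 → ∀ x,
      HasDerivAt (iteratedDeriv m w) (iteratedDeriv (m + 1) w x) x := fun m hm x => by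
    rw [iteratedDeriv_succ]
    exact (hw.differentiable_iteratedDeriv m (by exact_mod_cast hm) x).hasDerivAt
  exact ⟨by simpa using hd 0 (by norm_num), hd 1 (by norm_num), hd 2 (by norm_num), fun x y => by
    simpa [Real.dist_eq] using hK.dist_le_mul x y⟩

/-! ### Consistency of the discrete Caputo–Fabrizio derivative -/

/-- The slope equals v' c and is the mean of v' on [a, b], so v' c - v' integrates to zero and the
kernel may be reduced by its value at a. The integrand is then a product of factors at most M(b-a)
and σ(b-a), over length b - a. -/
theorem abs_integral_mul_exp_sub_le {σ M a b t : ℝ} (hσ : 0 ≤ σ) (hab : a < b) (hbt : b ≤ t)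
    {v v' : ℝ → ℝ} (hv : ContinuousOn v (Icc a b)) (hd : ∀ s ∈ Ioo a b, HasDerivAt v (v' s) s)
    (hv' : ContinuousOn v' (Icc a b))
    (hlip : ∀ s ∈ Icc a b, ∀ r ∈ Icc a b, |v' s - v' r| ≤ M * |s - r|) :
    |(v b - v a) / (b - a) * (∫ s in a..b, Real.exp (-σ * (t - s)))
      - ∫ s in a..b, v' s * Real.exp (-σ * (t - s))| ≤ M * σ * (b - a) ^ 3 := by
  have hba : 0 < b - a := sub_pos.2 hab
  obtain ⟨c, hc, hslope⟩ := exists_hasDerivAt_eq_slope v v' hab hv hd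
  rw [← hslope]
  have hM : 0 ≤ M := by
    have := (abs_nonneg _).trans (hlip b (right_mem_Icc.2 hab.le) a (left_mem_Icc.2 hab.le))
    rw [abs_of_pos hba] at this
    exact nonneg_of_mul_nonneg_left this hba
  have hE : Continuous fun s => Real.exp (-σ * (t - s)) := by fun_prop
  have hvI : IntervalIntegrable v' MeasureTheory.volume a b := by
    apply ContinuousOn.intervalIntegrable
    rwa [uIcc_of_le hab.le]
  have h0 : ∫ s in a..b, (v' c - v' s) * Real.exp (-σ * (t - a)) = 0 := by
    rw [intervalIntegral.integral_mul_const, intervalIntegral.integral_sub (by simp) hvI,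
      intervalIntegral.integral_eq_sub_of_hasDerivAt_of_le hab.le hv hd hvI,
      intervalIntegral.integral_const, hslope, smul_eq_mul]
    field_simp
    ring
  have h1 : ∀ {E : ℝ → ℝ} (e : ℝ), Continuous E → (∫ s in a..b, (v' c - v' s) * e) = 0 →
      v' c * (∫ s in a..b, E s) - ∫ s in a..b, v' s * E s
        = ∫ s in a..b, (v' c - v' s) * (E s - e) := by
    intro E e hE he
    simp only [mul_sub]
    have hi : IntervalIntegrable (fun s => v' c - v' s) MeasureTheory.volume a b :=
      intervalIntegrable_const.sub hvI
    rw [intervalIntegral.integral_sub (hi.mul_continuousOn hE.continuousOn)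
      (hi.mul_const _), he, sub_zero]
    simp only [sub_mul]
    rw [intervalIntegral.integral_sub ((hE.intervalIntegrable _ _).const_mul _)
      (hvI.mul_continuousOn hE.continuousOn), intervalIntegral.integral_const_mul]
  rw [h1 _ hE h0, ← Real.norm_eq_abs]
  refine (intervalIntegral.norm_integral_le_of_norm_le_const
    (C := M * (b - a) * (σ * (b - a))) fun s hs => ?_).trans (le_of_eq ?_)
  · rw [uIoc_of_le hab.le] at hs
    have hs' : s ∈ Icc a b := Ioc_subset_Icc_self hs
    rw [norm_mul, Real.norm_eq_abs, Real.norm_eq_abs]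
    refine mul_le_mul ((hlip c (Ioo_subset_Icc_self hc) s hs').trans
      (mul_le_mul_of_nonneg_left ?_ hM)) ?_ (abs_nonneg _) (by positivity)
    · rw [abs_le]; constructor <;> linarith [hc.1, hc.2, hs.1, hs.2]
    · have e1 : Real.exp (-σ * (t - a))
          = Real.exp (-σ * (t - s)) * Real.exp (-σ * (s - a)) := by
        rw [← Real.exp_add]; congr 1; ring
      have e2 : Real.exp (-σ * (t - s)) ≤ 1 := Real.exp_le_one_iff.2 (by
        nlinarith [mul_nonneg hσ (sub_nonneg.2 (hs.2.trans hbt))])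
      have e3 : Real.exp (-σ * (s - a)) ≤ 1 := Real.exp_le_one_iff.2 (by
        nlinarith [mul_nonneg hσ (sub_nonneg.2 hs.1.le)])
      have e4 := Real.add_one_le_exp (-σ * (s - a))
      have e5 : σ * (s - a) ≤ σ * (b - a) :=
        mul_le_mul_of_nonneg_left (by linarith [hs.2]) hσ
      rw [e1, show ∀ x y : ℝ, x - x * y = x * (1 - y) from fun x y => by ring, abs_mul,
        abs_of_pos (Real.exp_pos _), abs_of_nonneg (by linarith)]
      calc _ ≤ 1 * (1 - Real.exp (-σ * (s - a))) :=
            mul_le_mul_of_nonneg_right e2 (by linarith)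
        _ ≤ σ * (b - a) := by linarith
  · rw [abs_of_pos hba]; ring

theorem integral_exp_neg_mul_sub {σ : ℝ} (hσ : σ ≠ 0) (a b t : ℝ) :
    ∫ s in a..b, Real.exp (-σ * (t - s))
      = (Real.exp (-σ * (t - b)) - Real.exp (-σ * (t - a))) / σ := by
  have hd : ∀ s ∈ uIcc a b, HasDerivAt (fun s => Real.exp (-σ * (t - s)) / σ)
      (Real.exp (-σ * (t - s))) s := fun s _ => by
    have h1 : HasDerivAt (fun s => -σ * (t - s)) σ s :=
      (((hasDerivAt_id s).const_sub t).const_mul (-σ)).congr_deriv (by ring)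
    exact (h1.exp.div_const σ).congr_deriv (mul_div_cancel_right₀ _ hσ)
  rw [intervalIntegral.integral_eq_sub_of_hasDerivAt hd
    ((by fun_prop : Continuous fun s => Real.exp (-σ * (t - s))).intervalIntegrable _ _), sub_div]

/-- Consistency of the discrete Caputo–Fabrizio derivative, with an explicit constant. -/
theorem caputoFabrizio_consistency {γ T M : ℝ} (hγ₀ : 0 < γ) (hγ₁ : γ < 1) (hT : 0 < T)
    {v : ℝ → ℝ} (hv : ContDiffOn ℝ 2 v (Icc 0 T))
    (hM : ∀ t ∈ Icc 0 T, |iteratedDerivWithin 2 v (Icc 0 T) t| ≤ M) {τ : ℝ} (hτ : 0 < τ) {n : ℕ}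
    (hn : n * τ ≤ T) {σ : ℝ} (hσ : σ = γ / (1 - γ)) :
    |1 / (1 - γ) * ∑ k ∈ Finset.Icc 1 n, (v (k * τ) - v ((k - 1 : ℕ) * τ)) / (σ * τ)
        * Real.exp (-σ * ((n : ℝ) - k) * τ) * (1 - Real.exp (-σ * τ))
      - caputoFabrizio γ v (n * τ)| ≤ 1 / (1 - γ) * (M * σ * T) * τ ^ 2 := by
  have hγ : 0 < 1 - γ := by linarith
  have hσ0 : 0 < σ := hσ ▸ div_pos hγ₀ hγ
  have hu : UniqueDiffOn ℝ (Icc 0 T) := uniqueDiffOn_Icc hT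
  set v' := iteratedDerivWithin 1 v (Icc 0 T) with hv'_def
  have hdiff : DifferentiableOn ℝ v' (Icc 0 T) :=
    hv.differentiableOn_iteratedDerivWithin (by norm_num) hu
  have hlip : ∀ s ∈ Icc 0 T, ∀ r ∈ Icc 0 T, |v' s - v' r| ≤ M * |s - r| := fun s hs r hr =>
    (convex_Icc 0 T).norm_image_sub_le_of_norm_derivWithin_le hdiff (fun t ht => by
      have := hM t ht
      rwa [iteratedDerivWithin_succ] at this) hr hs
  have hd : ∀ s ∈ Ioo 0 T, HasDerivAt v (v' s) s := fun s hs => by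
    rw [hv'_def, iteratedDerivWithin_one]
    exact ((hv.differentiableOn (by norm_num)) s (Ioo_subset_Icc_self hs)).hasDerivWithinAt.hasDerivAt
      (Icc_mem_nhds hs.1 hs.2)
  have hM0 : 0 ≤ M := (abs_nonneg _).trans (hM 0 (left_mem_Icc.2 hT.le))
  have hnode : ∀ k : ℕ, k ≤ n → (k : ℝ) * τ ≤ n * τ := fun k hk =>
    mul_le_mul_of_nonneg_right (Nat.cast_le.2 hk) hτ.le
  have hsub : ∀ k : ℕ, k < n → Icc (k * τ) ((k + 1 : ℕ) * τ) ⊆ Icc 0 T := fun k hk =>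
    Icc_subset_Icc (by positivity) ((hnode (k + 1) hk).trans hn)
  have hlen : ∀ k : ℕ, ((k + 1 : ℕ) : ℝ) * τ - k * τ = τ := fun k => by push_cast; ring
  have hE : Continuous fun s => Real.exp (-σ * (n * τ - s)) := by fun_prop
  have hcell : ∀ k : ℕ, k < n →
      |(v ((k + 1 : ℕ) * τ) - v (k * τ)) / τ
          * (∫ s in k * τ..(k + 1 : ℕ) * τ, Real.exp (-σ * (n * τ - s)))
        - ∫ s in k * τ..(k + 1 : ℕ) * τ, v' s * Real.exp (-σ * (n * τ - s))|
      ≤ M * σ * τ ^ 3 := fun k hk => by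
    have := abs_integral_mul_exp_sub_le (v := v) hσ0.le (by linarith [hlen k]) (hnode (k + 1) hk)
      (hv.continuousOn.mono (hsub k hk)) (fun s hs => hd s ⟨?_, ?_⟩)
      (hdiff.continuousOn.mono (hsub k hk)) fun s hs r hr => hlip s (hsub k hk hs) r (hsub k hk hr)
    · rwa [hlen] at this
    · exact lt_of_le_of_lt (by positivity) hs.1
    · exact lt_of_lt_of_le hs.2 ((hnode (k + 1) hk).trans hn)
  have hint : ∫ s in (0 : ℝ)..n * τ, deriv v s * Real.exp (-σ * (n * τ - s))
      = ∑ k ∈ Finset.range n,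
        ∫ s in k * τ..(k + 1 : ℕ) * τ, v' s * Real.exp (-σ * (n * τ - s)) := by
    rw [intervalIntegral.sum_integral_adjacent_intervals (a := fun k : ℕ => (k : ℝ) * τ)
      fun k hk => ?_]
    · rw [Nat.cast_zero, zero_mul]
      -- The two-sided `deriv v` is controlled only in the open interval, since v is smooth merely
      -- on [0, T]; the endpoints do not affect the integral.
      refine intervalIntegral.integral_congr_Ioo_of_le (by positivity) fun s hs => ?_
      rw [(hd s ⟨hs.1, lt_of_lt_of_le hs.2 hn⟩).deriv]
    · refine ContinuousOn.intervalIntegrable ?_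
      rw [uIcc_of_le (by linarith [hlen k])]
      exact (hdiff.continuousOn.mono (hsub k hk)).mul hE.continuousOn
  -- The discrete weights are exact kernel integrals: the discrete derivative is the Caputo–Fabrizio
  -- integral of the piecewise linear interpolant.
  have hsum : ∑ k ∈ Finset.Icc 1 n, (v (k * τ) - v ((k - 1 : ℕ) * τ)) / (σ * τ)
        * Real.exp (-σ * ((n : ℝ) - k) * τ) * (1 - Real.exp (-σ * τ))
      = ∑ k ∈ Finset.range n, (v ((k + 1 : ℕ) * τ) - v (k * τ)) / τ
          * ∫ s in k * τ..(k + 1 : ℕ) * τ, Real.exp (-σ * (n * τ - s)) := by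
    rw [← Finset.Ico_add_one_right_eq_Icc, Finset.sum_Ico_eq_sum_range, Nat.add_sub_cancel]
    refine Finset.sum_congr rfl fun k _ => ?_
    have e : Real.exp (-σ * (n * τ - k * τ))
        = Real.exp (-σ * ((n : ℝ) - (k + 1 : ℕ)) * τ) * Real.exp (-σ * τ) := by
      rw [← Real.exp_add]; push_cast; congr 1; ring
    have e' : Real.exp (-σ * (n * τ - (k + 1 : ℕ) * τ))
        = Real.exp (-σ * ((n : ℝ) - (k + 1 : ℕ)) * τ) := by congr 1; ring
    rw [integral_exp_neg_mul_sub hσ0.ne', e, e', add_comm 1 k, Nat.add_sub_cancel]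
    field_simp
  rw [hsum, caputoFabrizio, ← hσ, hint, ← mul_sub, ← Finset.sum_sub_distrib, abs_mul,
    abs_of_pos (one_div_pos.2 hγ), mul_assoc]
  refine mul_le_mul_of_nonneg_left ?_ (one_div_pos.2 hγ).le
  calc _ ≤ ∑ k ∈ Finset.range n, M * σ * τ ^ 3 :=
        (Finset.abs_sum_le_sum_abs _ _).trans
          (Finset.sum_le_sum fun k hk => hcell k (Finset.mem_range.1 hk))
    _ = M * σ * τ ^ 2 * (n * τ) := by
        rw [Finset.sum_const, Finset.card_range, nsmul_eq_mul]; ring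
    _ ≤ M * σ * τ ^ 2 * T := mul_le_mul_of_nonneg_left hn (by positivity)
    _ = _ := by ring

/-! ### Assembly of the truncation bound and the theorem -/

/-- Second-order consistency of the difference scheme for smooth solutions. -/
theorem exists_truncationBound {P : CFProblem} {u : ℝ → ℝ → ℝ → ℝ} (hu : IsExactSolution P u)
    (hs : SufficientlySmooth P u) :
    ∃ C : ℝ, 0 < C ∧ ∀ m : CFMesh P, TruncationBound P m u C := by
  obtain ⟨M, hM⟩ := hs.time
  obtain ⟨Kx, hKx⟩ := hs.space_x
  obtain ⟨Ky, hKy⟩ := hs.space_y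
  set Ct := 1 / (1 - P.γ) * (|M| * P.σ * P.T) with hCt
  set Cx := rieszConst P.α * (2 * (3 * Kx * (2 * P.xR) ^ (2 - P.α)
    / ((2 - P.α) * Real.Gamma (2 - P.α)))) with hCx
  set Cy := rieszConst P.β * (2 * (3 * Ky * (2 * P.yR) ^ (2 - P.β)
    / ((2 - P.β) * Real.Gamma (2 - P.β)))) with hCy
  have hγ : 0 < 1 - P.γ := sub_pos.2 P.γ_lt_one
  have hCt0 : 0 ≤ Ct := by
    have := P.σ_pos
    have := P.T_pos
    positivity
  have hnn : ∀ {a L : ℝ} {K : ℝ≥0}, 1 < a → a < 2 → 0 < L →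
      0 ≤ rieszConst a * (2 * (3 * K * (2 * L) ^ (2 - a) / ((2 - a) * Real.Gamma (2 - a)))) := by
    intro a L K h1 h2 hL
    have := rieszConst_pos h1 h2
    have h3 : 0 < 2 - a := sub_pos.2 h2
    have := Real.Gamma_pos_of_pos h3
    positivity
  have hCx0 : 0 ≤ Cx := hnn P.one_lt_α P.α_lt_two P.xR_pos
  have hCy0 : 0 ≤ Cy := hnn P.one_lt_β P.β_lt_two P.yR_pos
  -- The 1 secures strict positivity even if all three consistency constants vanish.
  refine ⟨Ct + Cx + Cy + 1, by positivity, fun m n i j hn hnN hi hiN hj hjN => ?_⟩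
  have hx := m.x_mem_Ioo hi hiN
  have hy := m.y_mem_Ioo hj hjN
  have ht := m.t_mem_Ioc hn hnN
  have bt := caputoFabrizio_consistency P.γ_pos P.γ_lt_one P.T_pos (hM _ hx _ hy).1
    (fun t ht => ((hM _ hx _ hy).2 t ht).trans (le_abs_self M)) m.τ_pos
    (m.t_mem_Icc hnN).2 (σ := P.σ) rfl
  have bx := rieszDeriv_consistency
    (hasLipschitzThirdDeriv_of_contDiff (hKx _ hy _ ht).1 (hKx _ hy _ ht).2)
    P.one_lt_α P.α_lt_two m.Δx_pos m.Nx_mul_Δx hi hiN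
  have byy := rieszDeriv_consistency
    (hasLipschitzThirdDeriv_of_contDiff (hKy _ hx _ ht).1 (hKy _ hx _ ht).2)
    P.one_lt_β P.β_lt_two m.Δy_pos m.Ny_mul_Δy hj hjN
  have heq := hu.equation _ hx _ hy _ ht
  rw [truncationError]
  simp only [CFMesh.x, CFMesh.y, CFMesh.t] at heq bt bx byy ⊢
  rw [← hCt, abs_le] at bt
  rw [← hCx, abs_le] at bx
  rw [← hCy, abs_le] at byy
  have hτ2 := sq_nonneg m.τ
  have hx2 := sq_nonneg m.Δx
  have hy2 := sq_nonneg m.Δy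
  -- Subtracting the differential equation leaves one defect per variable. These products pay for
  -- the cross terms in (Ct + Cx + Cy)(τ² + Δx² + Δy²).
  have p1 := mul_nonneg (add_nonneg hCx0 hCy0) hτ2
  have p2 := mul_nonneg (add_nonneg hCt0 hCy0) hx2
  have p3 := mul_nonneg (add_nonneg hCt0 hCx0) hy2
  rw [abs_le]
  constructor <;> linarith [bt.1, bt.2, bx.1, bx.2, byy.1, byy.2]

theorem mainTheorem4 (P : CFProblem) (u : ℝ → ℝ → ℝ → ℝ) (hu : IsExactSolution P u) :
    (SufficientlySmooth P u →
      ∃ C : ℝ, 0 < C ∧ ∀ m : CFMesh P, TruncationBound P m u C) ∧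
    (∀ (m : CFMesh P) (C : ℝ), 0 < C → TruncationBound P m u C →
      ∀ U : ℕ → ℕ → ℕ → ℝ, IsSchemeSolution P m U →
        ∀ n : ℕ, 1 ≤ n → n ≤ m.N →
          m.maxNorm (fun i j => u (m.x i) (m.y j) (m.t n) - U n i j)
            ≤ (1 - P.γ) * (P.σ * P.T + Real.exp (P.σ * m.τ)) * C
                * (m.τ ^ 2 + m.Δx ^ 2 + m.Δy ^ 2)) :=
  ⟨exists_truncationBound hu, fun m _ hC hr _ hU _ hn hnN => maxNorm_error_le hu m hC hr hU hn hnN⟩
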